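/- Let $M$ be a connected smooth manifold of dimension $n\ge 2$, let $\alpha=\sqrt{a_{ij}(x)y^iy^j}$ be a smooth Riemannian metric and $\beta=b_i(x)y^i$ a smooth 1-form on $M$, and let $\phi$ be a smooth real function on an open subset of $\mathbb R$ containing all values $\beta(y)/\alpha(y)$ $(0\ne y\in TM)$, with $\phi(0)=1$, such that $F=\alpha\,\phi(\beta/\alpha)$ is a (regular) Finsler metric on $M$. Assume that there are no constant $k$ and no nonempty open set $U\subset M$ such that $\phi(s)=\sqrt{1+ks^2}$ for all the values $s=\beta(y)/\alpha(y)$, $0\neq y\in T_xM$, $x\in U$ (in other words, $F$ does not coincide with a Riemannian metric $\sqrt{\alpha^2+k\beta^2}$ over any nonempty open set; in particular, $\beta$ does not vanish identically on any nonempty open set). Put $b^2=\|\beta\|_\alpha^2=a^{ij}b_ib_j$, let $u,v,w$ be smooth real functions on an open subset of $\mathbb R$ containing all values of $b^2$, with $u$ and $w$ nowhere zero, and assume that $$h=\sqrt{u(b^2)\alpha^2+v(b^2)\beta^2}$$ is a Riemannian metric on $M$. Put $\rho=w(b^2)\beta=p_iy^i$, and suppose that $\rho$ is a conformal 1-form of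 $h$, i.e. $p_{i|j}y^iy^j=-2\sigma h^2$ for some function $\sigma$ on $M$, where $|$ is the covariant derivative of the Levi-Civita connection of $h$. Let $V$ be a smooth conformal vector field of $(M,F)$ with conformal factor $c:M\to\mathbb R$, that is, $$V_{i|j}\,y^iy^j=-2cF^2,\qquad V_i=g_{im}V^m,\quad g_{im}=\tfrac12\,\frac{\partial^2 F^2}{\partial y^i\partial y^m},$$ where $|$ is now the horizontal covariant derivative of the Berwald connection of $F$. Then $V$ is homothetic, i.e. $c$ is constant. -/

import Mathlib

open scoped Manifold ContDiff BigOperators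

noncomputable section

namespace Finsler

/-- The coordinate space `ℝⁿ`. -/
abbrev Coord (n : ℕ) := EuclideanSpace ℝ (Fin n)

/-! ### Calculus on `ℝⁿ × ℝⁿ` (positions `p`, directions `y`) -/

/-- The coordinate vector `e_i` of `ℝⁿ`. -/
def e {n : ℕ} (i : Fin n) : Coord n := EuclideanSpace.single i 1

/-- `∂f/∂xⁱ`. -/
def dX {n : ℕ} (i : Fin n) (f : Coord n → Coord n → ℝ) : Coord n → Coord n → ℝ :=
  fun p y => fderiv ℝ (fun q => f q y) p (e i)

/-- `∂f/∂yⁱ`. -/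
def dY {n : ℕ} (i : Fin n) (f : Coord n → Coord n → ℝ) : Coord n → Coord n → ℝ :=
  fun p y => fderiv ℝ (fun z => f p z) y (e i)

/-- The square `F²`. -/
def sqr {n : ℕ} (F : Coord n → Coord n → ℝ) : Coord n → Coord n → ℝ :=
  fun p y => F p y ^ 2

/-- The fundamental tensor `g_ij = ½ ∂²(F²)/∂yⁱ∂yʲ`. -/
def fund {n : ℕ} (F : Coord n → Coord n → ℝ) (p y : Coord n) : Matrix (Fin n) (Fin n) ℝ :=
  Matrix.of fun i j => (1 / 2) * dY i (dY j (sqr F)) p y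

/-- The spray coefficients `Gⁱ = ¼ g^{il} ( ∂²(F²)/∂xᵏ∂yˡ yᵏ - ∂(F²)/∂xˡ )`. -/
def spray {n : ℕ} (F : Coord n → Coord n → ℝ) (i : Fin n) : Coord n → Coord n → ℝ :=
  fun p y => (1 / 4) * ∑ l, (fund F p y)⁻¹ i l *
    ((∑ k, dX k (dY l (sqr F)) p y * y k) - dX l (sqr F) p y)

/-- The nonlinear connection `Nⁱ_j = ∂Gⁱ/∂yʲ`. -/
def nonlin {n : ℕ} (F : Coord n → Coord n → ℝ) (i j : Fin n) : Coord n → Coord n → ℝ :=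
  dY j (spray F i)

/-- The Berwald connection coefficients `Γⁱ_jk = ∂²Gⁱ/∂yʲ∂yᵏ`. If `F` is the norm of a
Riemannian metric, these are the Christoffel symbols of its Levi-Civita connection. -/
def berwald {n : ℕ} (F : Coord n → Coord n → ℝ) (i j k : Fin n) : Coord n → Coord n → ℝ :=
  dY k (nonlin F i j)

/-- The horizontal covariant derivative
`θ_{i|j} = ∂θ_i/∂xʲ - Nᵏ_j ∂θ_i/∂yᵏ - Γᵏ_ij θ_k` of a covector `θ_i(x,y)`
with respect to the Berwald connection of `F`. -/
def hcov {n : ℕ} (F : Coord n → Coord n → ℝ) (θ : Fin n → Coord n → Coord n → ℝ)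
    (i j : Fin n) (p y : Coord n) : ℝ :=
  dX j (θ i) p y - (∑ k, nonlin F k j p y * dY k (θ i) p y)
    - ∑ k, berwald F k i j p y * θ k p y

/-- `θ_{0|0} = θ_{i|j} yⁱ yʲ`. -/
def hcov00 {n : ℕ} (F : Coord n → Coord n → ℝ) (θ : Fin n → Coord n → Coord n → ℝ)
    (p y : Coord n) : ℝ :=
  ∑ i, ∑ j, hcov F θ i j p y * y i * y j

/-- Lowering the index with the fundamental tensor: `V_i(x,y) = g_im(x,y) Vᵐ(x)`. -/
def lower {n : ℕ} (F : Coord n → Coord n → ℝ) (V : Coord n → Coord n) (i : Fin n) :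
    Coord n → Coord n → ℝ :=
  fun p y => ∑ m, fund F p y i m * V p m

/-! ### Objects on a manifold, and their coordinate expressions -/

section Manifold

variable {n : ℕ} {M : Type*} [TopologicalSpace M] [ChartedSpace (Coord n) M]

/-- The tangent vector at the point with coordinates `p`, in the chart at `x₀`, whose coordinates
are `y`: the vector `yⁱ ∂/∂xⁱ`. -/
def chartVec (x₀ : M) (p y : Coord n) :
    TangentSpace (𝓡 n) ((extChartAt (𝓡 n) x₀).symm p) :=
  mfderiv 𝓘(ℝ, Coord n) (𝓡 n) (extChartAt (𝓡 n) x₀).symm p y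

/-- A function on the tangent bundle, in the coordinates `(x,y)` given by the chart at `x₀`. -/
def localFun (F : (x : M) → TangentSpace (𝓡 n) x → ℝ) (x₀ : M) :
    Coord n → Coord n → ℝ :=
  fun p y => F ((extChartAt (𝓡 n) x₀).symm p) (chartVec x₀ p y)

/-- The components `Vⁱ(x)` of a vector field in the chart at `x₀`. -/
def localField (V : (x : M) → TangentSpace (𝓡 n) x) (x₀ : M) : Coord n → Coord n :=
  fun p => mfderiv (𝓡 n) 𝓘(ℝ, Coord n) (extChartAt (𝓡 n) x₀)
    ((extChartAt (𝓡 n) x₀).symm p) (V ((extChartAt (𝓡 n) x₀).symm p))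

/-- The components `ρ_i(x)` of a 1-form in the chart at `x₀`, as functions of `(x,y)`. -/
def localForm (ρ : (x : M) → TangentSpace (𝓡 n) x →L[ℝ] ℝ) (x₀ : M) (i : Fin n) :
    Coord n → Coord n → ℝ :=
  fun p _ => ρ ((extChartAt (𝓡 n) x₀).symm p) (chartVec x₀ p (e i))

/-- Smooth vector fields. -/
def IsSmoothField [IsManifold (𝓡 n) ∞ M] (V : (x : M) → TangentSpace (𝓡 n) x) : Prop :=
  ContMDiff (𝓡 n) (𝓡 n).tangent ∞ (fun x => (⟨x, V x⟩ : TangentBundle (𝓡 n) M))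

/-- Smooth 1-forms. -/
def IsSmoothForm [IsManifold (𝓡 n) ∞ M]
    (ρ : (x : M) → TangentSpace (𝓡 n) x →L[ℝ] ℝ) : Prop :=
  ContMDiff (𝓡 n) ((𝓡 n).prod 𝓘(ℝ, Coord n →L[ℝ] ℝ)) ∞
    (fun x => Bundle.TotalSpace.mk' (Coord n →L[ℝ] ℝ)
      (E := fun x : M => TangentSpace (𝓡 n) x →L[ℝ] Bundle.Trivial M ℝ x) x (ρ x))

/-- (Regular) Finsler metrics: positive, positively homogeneous functions on the tangent bundle,
smooth off the zero section, with positive definite fundamental tensor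
`g_y(z,z) = ½ d²/dt² F²(y + t z)` at `t = 0`. -/
structure IsFinslerMetric [IsManifold (𝓡 n) ∞ M]
    (F : (x : M) → TangentSpace (𝓡 n) x → ℝ) : Prop where
  smooth : ContMDiffOn (𝓡 n).tangent 𝓘(ℝ) ∞
    (fun v : TangentBundle (𝓡 n) M => F v.proj v.snd) {v | v.snd ≠ 0}
  pos : ∀ (x : M) (y : TangentSpace (𝓡 n) x), y ≠ 0 → 0 < F x y
  homog : ∀ (x : M) (y : TangentSpace (𝓡 n) x) (t : ℝ), 0 < t → F x (t • y) = t * F x y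
  convex : ∀ (x : M) (y z : TangentSpace (𝓡 n) x), y ≠ 0 → z ≠ 0 →
    0 < (1 / 2) * iteratedDeriv 2 (fun t : ℝ => F x (y + t • z) ^ 2) 0

/-- `V` is a conformal vector field of `(M,F)` with conformal factor `c`:
`V_{0|0} = -2 c F²` on nonzero tangent vectors, in every chart. -/
def IsConformalField (F : (x : M) → TangentSpace (𝓡 n) x → ℝ)
    (V : (x : M) → TangentSpace (𝓡 n) x) (c : M → ℝ) : Prop :=
  ∀ x₀ : M, ∀ p ∈ (extChartAt (𝓡 n) x₀).target, ∀ y : Coord n, y ≠ 0 →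
    hcov00 (localFun F x₀) (lower (localFun F x₀) (localField V x₀)) p y
      = -2 * c ((extChartAt (𝓡 n) x₀).symm p) * localFun F x₀ p y ^ 2

/-- `ρ` is a conformal 1-form of `(M,F)`: `ρ_{0|0} = -2 σ F²` for some function `σ` on `M`. -/
def IsConformalForm (F : (x : M) → TangentSpace (𝓡 n) x → ℝ)
    (ρ : (x : M) → TangentSpace (𝓡 n) x →L[ℝ] ℝ) : Prop :=
  ∃ σ : M → ℝ, ∀ x₀ : M, ∀ p ∈ (extChartAt (𝓡 n) x₀).target, ∀ y : Coord n, y ≠ 0 →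
    hcov00 (localFun F x₀) (localForm ρ x₀) p y
      = -2 * σ ((extChartAt (𝓡 n) x₀).symm p) * localFun F x₀ p y ^ 2

/-- Smooth Riemannian metrics on `M`. -/
abbrev Riem (n : ℕ) (M : Type*) [TopologicalSpace M] [ChartedSpace (Coord n) M]
    [IsManifold (𝓡 n) ∞ M] :=
  Bundle.ContMDiffRiemannianMetric (𝓡 n) ∞ (Coord n) (fun x : M => TangentSpace (𝓡 n) x)

variable [IsManifold (𝓡 n) ∞ M]

/-- The norm `α = √(a_ij yⁱ yʲ)` of a Riemannian metric. -/
def rnorm (a : Riem n M) (x : M) (y : TangentSpace (𝓡 n) x) : ℝ :=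
  Real.sqrt (a.inner x y y)

theorem exists_sharp (a : Riem n M) (x : M) (b : TangentSpace (𝓡 n) x →L[ℝ] ℝ) :
    ∃ z : TangentSpace (𝓡 n) x, ∀ y, a.inner x z y = b y := by
  have : FiniteDimensional ℝ (TangentSpace (𝓡 n) x) :=
    inferInstanceAs (FiniteDimensional ℝ (Coord n))
  let L : TangentSpace (𝓡 n) x →ₗ[ℝ] Module.Dual ℝ (TangentSpace (𝓡 n) x) :=
    { toFun := fun z => (a.inner x z).toLinearMap
      map_add' := fun z z' => by ext y; simp
      map_smul' := fun r z => by ext y; simp }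
  have hinj : Function.Injective L := by
    rw [injective_iff_map_eq_zero]
    intro z hz
    by_contra hne
    have h2 : a.inner x z z = 0 := congrArg (fun f => f z) hz
    exact absurd h2 (a.pos x z hne).ne'
  obtain ⟨z, hz⟩ := (LinearMap.injective_iff_surjective_of_finrank_eq_finrank
    (Subspace.dual_finrank_eq (K := ℝ) (V := TangentSpace (𝓡 n) x)).symm).1 hinj b.toLinearMap
  exact ⟨z, fun y => congrArg (fun f => f y) hz⟩

/-- The tangent vector `bⁱ = a^{ij} b_j` dual to a covector. -/
def sharp (a : Riem n M) (x : M) (b : TangentSpace (𝓡 n) x →L[ℝ] ℝ) :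
    TangentSpace (𝓡 n) x :=
  (exists_sharp a x b).choose

theorem inner_sharp (a : Riem n M) (x : M) (b : TangentSpace (𝓡 n) x →L[ℝ] ℝ)
    (y : TangentSpace (𝓡 n) x) : a.inner x (sharp a x b) y = b y :=
  (exists_sharp a x b).choose_spec y

/-- `b² = ‖β‖²_α = a^{ij} b_i b_j = b_i bⁱ`. -/
def bsq (a : Riem n M) (β : (x : M) → TangentSpace (𝓡 n) x →L[ℝ] ℝ) (x : M) : ℝ :=
  β x (sharp a x (β x))

/-- The function `F = α φ(β/α)`. -/
def alphaBeta (a : Riem n M) (β : (x : M) → TangentSpace (𝓡 n) x →L[ℝ] ℝ) (φ : ℝ → ℝ)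
    (x : M) (y : TangentSpace (𝓡 n) x) : ℝ :=
  rnorm a x y * φ (β x y / rnorm a x y)

end Manifold

end Finsler

end

/-!
The proof reads the hypotheses as statements about Lie derivatives and then computes one bracket.

For any Finsler metric `F`, the expression `V_{0|0}` formed with the Berwald connection is half the
derivative of `F²` along the complete lift `Vᶜ = Vⁱ ∂/∂xⁱ + yʲ ∂_j Vⁱ ∂/∂yⁱ` (`hcov00_eq`); this is
Euler's theorem for the homogeneous spray coefficients, together with the equation
`4 g_{mk} Gᵏ = ∂²(F²)/∂xᵏ∂yᵐ yᵏ - ∂(F²)/∂xᵐ` that defines them. So `V` is conformal with factor `c`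
exactly when `Vᶜ(F²) = -4 c F²`. In the same way, `ρ` is a conformal 1-form of `h` exactly when its
dual field `X` satisfies `L_X h² = -4 σ h²` (`hcov00_metric`).

For `F = α φ(β/α)`, put `Q = L_V α² + 4 c α²` and `L = L_V β + 2 c β`. The conformal equation becomes
`Q (φ - s φ') + 2 α φ' L = 0` at each point. On the vectors `τ β♯ ± κ e` with `β(e) = 0` it splits
into two equations of the form `q s (φ - s φ') + l φ' = 0`, whose only solutions with `φ(0) = 1`
and `(q, l) ≠ 0` have `φ² = 1 + k s²` (`sq_eq_of_ode`, `eq_zero_or_sq_eq`). On the open set where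
`Q` and `L` do not both vanish, the constant `k` is the same at all points with `β ≠ 0`, so the
non-Riemannian hypothesis makes that set empty (`lieBilin_eq_and_lieForm_eq`).

Thus `L_V α² = -4 c α²` and `L_V β = -2 c β`. Hence `V` preserves `b²`, and `h²` and `ρ` scale as
`α²` and `β` do; it follows that `[V, X] = 2 c X` (`fderiv_dual_sub`). Comparing
`L_{[V, X]} h² = L_V L_X h² - L_X L_V h²` with `L_{2cX} h²` shows that `dc ⊗ ρ + ρ ⊗ dc` is a
multiple of `h²` (`exists_fderiv_mul_eq`). In dimension at least two, evaluation on the kernel of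
`ρ` gives `dc = 0` wherever `ρ ≠ 0`, which is a dense set, and so `c` is constant.
-/

noncomputable section

namespace Finsler

/-! ### Homogeneous functions and the Berwald connection -/

section Calculus

variable {n : ℕ}

/-- Smoothness of a function of position and direction over `T`, off the zero section. -/
def SmoothOff (T : Set (Coord n)) (f : Coord n → Coord n → ℝ) : Prop :=
  ContDiffOn ℝ ∞ (fun z : Coord n × Coord n => f z.1 z.2) (T ×ˢ {0}ᶜ)

/-- Positive homogeneity of degree `k` in the direction, at all positions and directions. -/
def Homog (k : ℕ) (f : Coord n → Coord n → ℝ) : Prop :=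
  ∀ p y, ∀ t : ℝ, 0 < t → f p (t • y) = t ^ k * f p y

theorem sum_coord_smul_e (y : Coord n) : ∑ i, y i • e i = y := by
  ext j
  simp [e, Pi.single_apply]

theorem sum_mul_apply_e (L : Coord n →L[ℝ] ℝ) (y : Coord n) : ∑ i, y i * L (e i) = L y := by
  conv_rhs => rw [← sum_coord_smul_e y]
  simp

theorem fderiv_const_smul_fun (r : ℝ) (g : Coord n → ℝ) (x : Coord n) :
    fderiv ℝ (fun z => r • g z) x = r • fderiv ℝ g x :=
  congrFun (fderiv_const_smul_field (𝕜 := ℝ) (f := g) r) x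

theorem iteratedDeriv_two_line {g : Coord n → ℝ} {y : Coord n} (hg : ContDiffAt ℝ ∞ g y)
    (z : Coord n) :
    iteratedDeriv 2 (fun t : ℝ => g (y + t • z)) 0 = fderiv ℝ (fderiv ℝ g) y z z := by
  have hl : ∀ t : ℝ, HasDerivAt (fun t : ℝ => y + t • z) z t := fun t => by
    simpa using ((hasDerivAt_id t).smul_const z).const_add y
  have hev : ∀ᶠ t : ℝ in nhds 0, ContDiffAt ℝ 1 g (y + t • z) := by
    refine (hl 0).continuousAt.eventually ?_
    simp only [zero_smul, add_zero]
    exact (hg.of_le (by exact_mod_cast le_top)).eventually (by simp)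
  have h1 : deriv (fun t : ℝ => g (y + t • z)) =ᶠ[nhds 0] fun t => fderiv ℝ g (y + t • z) z := by
    filter_upwards [hev] with t ht
    exact ((ht.differentiableAt (by simp)).hasFDerivAt.comp_hasDerivAt t (hl t)).deriv
  have hd : HasFDerivAt (fderiv ℝ g) (fderiv ℝ (fderiv ℝ g) y) (y + (0 : ℝ) • z) := by
    rw [zero_smul, add_zero]
    exact ((hg.fderiv_right (m := ∞) (by simp)).differentiableAt (by simp)).hasFDerivAt
  have h2 : HasDerivAt (fun t : ℝ => fderiv ℝ g (y + t • z)) (fderiv ℝ (fderiv ℝ g) y z) 0 :=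
    hd.comp_hasDerivAt (0 : ℝ) (hl 0)
  have h3 : HasDerivAt (fun t : ℝ => fderiv ℝ g (y + t • z) z) (fderiv ℝ (fderiv ℝ g) y z z) 0 := by
    simpa using h2.clm_apply (hasDerivAt_const (0 : ℝ) z)
  rw [iteratedDeriv_succ, iteratedDeriv_one, h1.deriv_eq, h3.deriv]

theorem isOpen_prod_compl {T : Set (Coord n)} (hT : IsOpen T) :
    IsOpen (T ×ˢ ({0}ᶜ : Set (Coord n))) :=
  hT.prod isOpen_compl_singleton

namespace SmoothOff

variable {T : Set (Coord n)} {f g : Coord n → Coord n → ℝ}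

theorem contDiffAt (hf : SmoothOff T f) (hT : IsOpen T) {p y : Coord n} (hp : p ∈ T)
    (hy : y ≠ 0) : ContDiffAt ℝ ∞ (fun z : Coord n × Coord n => f z.1 z.2) (p, y) :=
  ContDiffOn.contDiffAt hf ((isOpen_prod_compl hT).mem_nhds (Set.mk_mem_prod hp hy))

theorem differentiableAt (hf : SmoothOff T f) (hT : IsOpen T) {p y : Coord n} (hp : p ∈ T)
    (hy : y ≠ 0) : DifferentiableAt ℝ (fun z : Coord n × Coord n => f z.1 z.2) (p, y) :=
  (hf.contDiffAt hT hp hy).differentiableAt (by simp)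

theorem hasFDerivAt_left (hf : SmoothOff T f) (hT : IsOpen T) {p y : Coord n} (hp : p ∈ T)
    (hy : y ≠ 0) : HasFDerivAt (fun q => f q y)
      ((fderiv ℝ (fun z : Coord n × Coord n => f z.1 z.2) (p, y)).comp
        (ContinuousLinearMap.inl ℝ _ _)) p :=
  HasFDerivAt.comp (g := fun z : Coord n × Coord n => f z.1 z.2) (f := fun q => (q, y)) p
    (hf.differentiableAt hT hp hy).hasFDerivAt (hasFDerivAt_prodMk_left p y)

theorem hasFDerivAt_right (hf : SmoothOff T f) (hT : IsOpen T) {p y : Coord n} (hp : p ∈ T)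
    (hy : y ≠ 0) : HasFDerivAt (fun z => f p z)
      ((fderiv ℝ (fun z : Coord n × Coord n => f z.1 z.2) (p, y)).comp
        (ContinuousLinearMap.inr ℝ _ _)) y :=
  HasFDerivAt.comp (g := fun z : Coord n × Coord n => f z.1 z.2) (f := fun z => (p, z)) y
    (hf.differentiableAt hT hp hy).hasFDerivAt (hasFDerivAt_prodMk_right p y)

theorem dX (hf : SmoothOff T f) (hT : IsOpen T) (i : Fin n) : SmoothOff T (dX i f) := by
  have h1 := hf.fderiv_of_isOpen (m := ∞) (isOpen_prod_compl hT) (by simp)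
  refine (h1.clm_apply (contDiffOn_const (c := ((e i, 0) : Coord n × Coord n)))).congr ?_
  rintro ⟨p, y⟩ ⟨hp, hy⟩
  simp only [Finsler.dX]
  rw [(hf.hasFDerivAt_left hT hp hy).fderiv]
  simp

theorem dY (hf : SmoothOff T f) (hT : IsOpen T) (i : Fin n) : SmoothOff T (dY i f) := by
  have h1 := hf.fderiv_of_isOpen (m := ∞) (isOpen_prod_compl hT) (by simp)
  refine (h1.clm_apply (contDiffOn_const (c := ((0, e i) : Coord n × Coord n)))).congr ?_
  rintro ⟨p, y⟩ ⟨hp, hy⟩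
  simp only [Finsler.dY]
  rw [(hf.hasFDerivAt_right hT hp hy).fderiv]
  simp

theorem sum {ι : Type*} {s : Finset ι} {f : ι → Coord n → Coord n → ℝ}
    (h : ∀ i ∈ s, SmoothOff T (f i)) : SmoothOff T (fun p y => ∑ i ∈ s, f i p y) :=
  ContDiffOn.sum h

theorem mul (hf : SmoothOff T f) (hg : SmoothOff T g) : SmoothOff T (fun p y => f p y * g p y) :=
  ContDiffOn.mul hf hg

theorem sub (hf : SmoothOff T f) (hg : SmoothOff T g) : SmoothOff T (fun p y => f p y - g p y) :=
  ContDiffOn.sub hf hg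

theorem const (r : ℝ) : SmoothOff T (fun _ _ => r) := contDiffOn_const

theorem coord (k : Fin n) : SmoothOff T (fun _ y => y k) := by
  unfold SmoothOff
  fun_prop

theorem prod {ι : Type*} {s : Finset ι} {f : ι → Coord n → Coord n → ℝ}
    (h : ∀ i ∈ s, SmoothOff T (f i)) : SmoothOff T (fun p y => ∏ i ∈ s, f i p y) :=
  contDiffOn_prod h

theorem det {m : ℕ} {A : Coord n → Coord n → Matrix (Fin m) (Fin m) ℝ}
    (h : ∀ i j, SmoothOff T (fun p y => A p y i j)) : SmoothOff T (fun p y => (A p y).det) := by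
  simp only [Matrix.det_apply']
  exact sum fun σ _ => (const _).mul (prod fun i _ => h _ _)

theorem inv_apply {m : ℕ} {A : Coord n → Coord n → Matrix (Fin m) (Fin m) ℝ}
    (h : ∀ i j, SmoothOff T (fun p y => A p y i j))
    (hdet : ∀ p ∈ T, ∀ y, y ≠ 0 → (A p y).det ≠ 0) (i j : Fin m) :
    SmoothOff T (fun p y => (A p y)⁻¹ i j) := by
  have hadj : SmoothOff T (fun p y => (A p y).adjugate i j) := by
    simp only [Matrix.adjugate_apply]
    refine det fun k l => ?_
    by_cases hk : k = j
    · subst hk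
      simpa using const _
    · simpa [Matrix.updateRow_ne hk] using h k l
  have hd : SmoothOff T (fun p y => ((A p y).det)⁻¹) :=
    ContDiffOn.inv (det h) fun z hz => hdet _ hz.1 _ hz.2
  simpa [Matrix.inv_def] using hd.mul hadj

/-- Euler's theorem on homogeneous functions. -/
theorem euler (hf : SmoothOff T f) (hT : IsOpen T) {k : ℕ} (hk : Homog k f) {p y : Coord n}
    (hp : p ∈ T) (hy : y ≠ 0) : ∑ i, y i * Finsler.dY i f p y = k * f p y := by
  simp only [Finsler.dY]
  rw [sum_mul_apply_e]
  have h1 := (hf.hasFDerivAt_right hT hp hy).differentiableAt.hasFDerivAt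
  have h2 : HasDerivAt (fun t : ℝ => t • y) y 1 := by
    simpa using (hasDerivAt_id (1 : ℝ)).smul_const y
  have h3 : HasDerivAt (fun t : ℝ => f p (t • y)) (fderiv ℝ (fun z => f p z) y y) 1 := by
    have h1' : HasFDerivAt (fun z => f p z) (fderiv ℝ (fun z => f p z) y) ((1 : ℝ) • y) := by
      simpa using h1
    exact h1'.comp_hasDerivAt (1 : ℝ) h2
  have h4 : HasDerivAt (fun t : ℝ => t ^ k * f p y) (k * f p y) 1 := by
    simpa using (hasDerivAt_pow k (1 : ℝ)).mul_const (f p y)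
  refine h3.unique (h4.congr_of_eventuallyEq ?_)
  filter_upwards [lt_mem_nhds (zero_lt_one' ℝ)] with t ht using hk p y t ht

end SmoothOff

namespace Homog

variable {f g : Coord n → Coord n → ℝ} {k : ℕ}

theorem dY (h : Homog (k + 1) f) (i : Fin n) : Homog k (dY i f) := by
  intro p y t ht
  have h1 : (fun z => f p (t • z)) = fun z => t ^ (k + 1) • f p z := by
    ext z
    simp [h p z t ht]
  have h2 := fderiv_comp_smul (𝕜 := ℝ) (f := f p) (x := y) t
  rw [h1, fderiv_const_smul_fun] at h2
  have h3 := congrArg (fun L => L (e i)) h2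
  simp only [smul_apply, smul_eq_mul, pow_succ'] at h3
  simp only [Finsler.dY]
  have := mul_left_cancel₀ ht.ne' ((mul_assoc _ _ _).symm.trans h3)
  exact this.symm

theorem dX (h : Homog k f) (i : Fin n) : Homog k (dX i f) := by
  intro p y t ht
  have h1 : (fun q => f q (t • y)) = fun q => t ^ k • f q y := by
    ext q
    simp [h q y t ht]
  simp only [Finsler.dX]
  rw [h1, fderiv_const_smul_fun]
  simp

end Homog

section Spray

variable {T : Set (Coord n)} {F : Coord n → Coord n → ℝ}

theorem homog_sqr (hF : Homog 1 F) : Homog 2 (sqr F) := by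
  intro p y t ht
  simp only [sqr, hF p y t ht]
  ring

theorem smoothOff_fund (hT : IsOpen T) (hf : SmoothOff T (sqr F)) (i j : Fin n) :
    SmoothOff T (fun p y => fund F p y i j) :=
  (SmoothOff.const (1 / 2)).mul ((hf.dY hT j).dY hT i)

theorem contDiffAt_sqr (hT : IsOpen T) (hf : SmoothOff T (sqr F)) {p y : Coord n} (hp : p ∈ T)
    (hy : y ≠ 0) : ContDiffAt ℝ ∞ (fun z => sqr F p z) y :=
  (hf.contDiffAt hT hp hy).comp y (contDiffAt_const.prodMk contDiffAt_id)

theorem fund_eq (hT : IsOpen T) (hf : SmoothOff T (sqr F)) {p y : Coord n} (hp : p ∈ T)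
    (hy : y ≠ 0) (i j : Fin n) :
    fund F p y i j = (1 / 2) * fderiv ℝ (fderiv ℝ (fun z => sqr F p z)) y (e i) (e j) := by
  have hd : DifferentiableAt ℝ (fderiv ℝ (fun z => sqr F p z)) y :=
    ((contDiffAt_sqr hT hf hp hy).fderiv_right (m := ∞) (by simp)).differentiableAt (by simp)
  simp only [fund, Matrix.of_apply, dY]
  rw [fderiv_clm_apply hd (differentiableAt_const _)]
  simp

theorem two_le_infty : minSmoothness ℝ 2 ≤ (∞ : WithTop ℕ∞) := by
  simp only [minSmoothness_of_isRCLikeNormedField]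
  exact WithTop.coe_le_coe.2 le_top

theorem fund_symm (hT : IsOpen T) (hf : SmoothOff T (sqr F)) {p y : Coord n} (hp : p ∈ T)
    (hy : y ≠ 0) (i j : Fin n) : fund F p y i j = fund F p y j i := by
  have hsymm : IsSymmSndFDerivAt ℝ (fun z => sqr F p z) y :=
    (contDiffAt_sqr hT hf hp hy).isSymmSndFDerivAt two_le_infty
  rw [fund_eq hT hf hp hy, fund_eq hT hf hp hy, hsymm.eq]

theorem det_fund_ne_zero (hT : IsOpen T) (hf : SmoothOff T (sqr F)) {p y : Coord n} (hp : p ∈ T)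
    (hy : y ≠ 0)
    (h : ∀ z, z ≠ 0 → 0 < (1 / 2) * iteratedDeriv 2 (fun t : ℝ => sqr F p (y + t • z)) 0) :
    (fund F p y).det ≠ 0 := by
  intro hdet
  obtain ⟨v, hv, hv0⟩ := Matrix.exists_mulVec_eq_zero_iff.2 hdet
  set z : Coord n := WithLp.toLp 2 v with hz
  have hz0 : z ≠ 0 := by
    intro h0
    exact hv (by simpa [hz] using h0)
  refine (h z hz0).ne' ?_
  rw [iteratedDeriv_two_line (contDiffAt_sqr hT hf hp hy)]
  set D := fderiv ℝ (fderiv ℝ (fun z => sqr F p z)) y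
  have h1 : ∀ i, (1 / 2) * D (e i) z = 0 := by
    intro i
    rw [← sum_mul_apply_e (D (e i)) z, Finset.mul_sum]
    have h2 := congrFun hv0 i
    simp only [Matrix.mulVec, dotProduct, Pi.zero_apply] at h2
    rw [← h2]
    refine Finset.sum_congr rfl fun j _ => ?_
    rw [fund_eq hT hf hp hy]
    simp only [hz]
    ring
  have h3 := sum_mul_apply_e (D.flip z) z
  simp only [ContinuousLinearMap.flip_apply] at h3
  rw [← h3, Finset.mul_sum]
  refine Finset.sum_eq_zero fun i _ => ?_
  linear_combination z i * h1 i

theorem homog_spray (hF : Homog 1 F) (i : Fin n) : Homog 2 (spray F i) := by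
  intro p y t ht
  have h2 := homog_sqr hF
  have hfund : fund F p (t • y) = fund F p y := by
    ext i j
    have := ((h2.dY j).dY i) p y t ht
    simp only [fund, Matrix.of_apply, this]
    simp
  simp only [spray, hfund]
  have hx : ∀ l, dX l (sqr F) p (t • y) = t ^ 2 * dX l (sqr F) p y := fun l =>
    (h2.dX l) p y t ht
  have hxy : ∀ k l, dX k (dY l (sqr F)) p (t • y) = t ^ 1 * dX k (dY l (sqr F)) p y := fun k l =>
    ((h2.dY l).dX k) p y t ht
  simp only [hx, hxy, PiLp.smul_apply, smul_eq_mul, Finset.mul_sum, mul_sub]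
  refine Finset.sum_congr rfl fun l _ => ?_
  congr 1
  · refine Finset.sum_congr rfl fun k _ => ?_
    ring
  · ring

theorem smoothOff_spray (hT : IsOpen T) (hf : SmoothOff T (sqr F))
    (hdet : ∀ p ∈ T, ∀ y, y ≠ 0 → (fund F p y).det ≠ 0) (i : Fin n) :
    SmoothOff T (spray F i) := by
  refine (SmoothOff.const (1 / 4)).mul (SmoothOff.sum fun l _ => ?_)
  refine (SmoothOff.inv_apply (smoothOff_fund hT hf) hdet i l).mul ?_
  exact (SmoothOff.sum fun k _ => ((hf.dY hT l).dX hT k).mul (SmoothOff.coord k)).sub (hf.dX hT l)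

/-- For the spray `Gⁱ` of `F`, `4 g_{mk} Gᵏ = ∂²(F²)/∂xᵏ∂yᵐ yᵏ - ∂(F²)/∂xᵐ`. -/
theorem sum_fund_mul_spray (hdet : ∀ p ∈ T, ∀ y, y ≠ 0 → (fund F p y).det ≠ 0) {p y : Coord n}
    (hp : p ∈ T) (hy : y ≠ 0) (m : Fin n) :
    ∑ k, fund F p y m k * spray F k p y
      = (1 / 4) * ((∑ k, dX k (dY m (sqr F)) p y * y k) - dX m (sqr F) p y) := by
  set R : Fin n → ℝ := fun l => (∑ k, dX k (dY l (sqr F)) p y * y k) - dX l (sqr F) p y with hR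
  have h1 : (fund F p y).mulVec ((fund F p y)⁻¹.mulVec R) = R := by
    rw [Matrix.mulVec_mulVec, Matrix.mul_nonsing_inv _ (isUnit_iff_ne_zero.2 (hdet p hp y hy)),
      Matrix.one_mulVec]
  have h2 := congrFun h1 m
  simp only [Matrix.mulVec, dotProduct] at h2
  change _ = (1 / 4) * R m
  rw [← h2, Finset.mul_sum]
  refine Finset.sum_congr rfl fun k _ => ?_
  simp only [spray, hR]
  ring

/-- The horizontal derivative `V_{0|0}` for the Berwald connection of `F` is half the derivative
of `F²` along the complete lift `Vⁱ ∂/∂xⁱ + yʲ ∂_j Vⁱ ∂/∂yⁱ` of `V`: the spray is a geodesic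
spray, so that along it the derivative of `∂(F²)/∂yᵐ` is `∂(F²)/∂xᵐ`. -/
theorem hcov00_eq (hT : IsOpen T) (hF : Homog 1 F) (hf : SmoothOff T (sqr F))
    (hdet : ∀ p ∈ T, ∀ y, y ≠ 0 → (fund F p y).det ≠ 0) {V : Coord n → Coord n}
    (hV : DifferentiableOn ℝ V T) {θ : Fin n → Coord n → Coord n → ℝ}
    (hθ : ∀ i, ∀ p ∈ T, ∀ y, y ≠ 0 → θ i p y = lower F V i p y) {p y : Coord n} (hp : p ∈ T)
    (hy : y ≠ 0) :
    hcov00 F θ p y = (1 / 2) * (fderiv ℝ (fun q => sqr F q y) p (V p)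
      + fderiv ℝ (fun z => sqr F p z) y (fderiv ℝ V p y)) := by
  have h2 := homog_sqr hF
  have hG := smoothOff_spray hT hf hdet
  -- contractions of the connection with `y`, by Euler's theorem
  have hN : ∀ k, ∑ j, y j * nonlin F k j p y = 2 * spray F k p y := fun k => by
    exact_mod_cast (hG k).euler hT (homog_spray hF k) hp hy
  have hB : ∀ k i, ∑ j, y j * berwald F k i j p y = nonlin F k i p y := fun k i => by
    have := ((hG k).dY hT i).euler hT ((homog_spray hF k).dY i) hp hy
    rwa [Nat.cast_one, one_mul] at this
  have hfy : ∀ q ∈ T, ∀ z, z ≠ 0 → ∀ m, ∑ i, z i * fund F q z i m = (1 / 2) * dY m (sqr F) q z := by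
    intro q hq z hz m
    have := (hf.dY hT m).euler hT (h2.dY m) hq hz
    simp only [Nat.cast_one, one_mul] at this
    rw [← this, Finset.mul_sum]
    refine Finset.sum_congr rfl fun i _ => ?_
    simp only [fund, Matrix.of_apply]
    ring
  have hdf0 : ∀ m k, ∑ i, y i * dY k (fun q z => fund F q z i m) p y = 0 := by
    intro m k
    have hl : fderiv ℝ (fun z => ∑ i, z i * fund F p z i m) y (e k)
        = fund F p y k m + ∑ i, y i * dY k (fun q z => fund F q z i m) p y := by
      have hd : ∀ i, DifferentiableAt ℝ (fun z => fund F p z i m) y := fun i =>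
        ((smoothOff_fund hT hf i m).hasFDerivAt_right hT hp hy).differentiableAt
      have hc : ∀ i, DifferentiableAt ℝ (fun z : Coord n => z i) y := fun i => by fun_prop
      have he : ∀ i, fderiv ℝ (fun z : Coord n => z i) y (e k) = if i = k then 1 else 0 := by
        intro i
        have : HasFDerivAt (fun z : Coord n => z i) (EuclideanSpace.proj (𝕜 := ℝ) i) y :=
          (EuclideanSpace.proj (𝕜 := ℝ) i).hasFDerivAt
        rw [this.fderiv]
        simp [e]
      rw [fderiv_fun_sum fun i _ => (hc i).fun_mul (hd i)]
      simp only [sum_apply]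
      have : ∀ i, fderiv ℝ (fun z : Coord n => z i * fund F p z i m) y (e k)
          = (if i = k then fund F p y i m else 0) + y i * dY k (fun q z => fund F q z i m) p y := by
        intro i
        rw [fderiv_fun_mul (hc i) (hd i)]
        simp only [add_apply, smul_apply, smul_eq_mul, he,
          dY]
        split_ifs <;> ring
      simp [this, Finset.sum_add_distrib]
    have hr : fderiv ℝ (fun z => ∑ i, z i * fund F p z i m) y (e k) = fund F p y k m := by
      have : (fun z => ∑ i, z i * fund F p z i m) =ᶠ[nhds y]
          fun z => (1 / 2 : ℝ) • dY m (sqr F) p z := by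
        filter_upwards [isOpen_compl_singleton.mem_nhds hy] with z hz
        simpa using hfy p hp z hz m
      rw [this.fderiv_eq, fderiv_const_smul_fun]
      simp only [fund, Matrix.of_apply, smul_apply, smul_eq_mul]
      rfl
    linarith
  have hVd : DifferentiableAt ℝ V p := (hV p hp).differentiableAt (hT.mem_nhds hp)
  have hVm : ∀ m, DifferentiableAt ℝ (fun q => V q m) p := fun m => by fun_prop
  have hVe : ∀ m v, fderiv ℝ (fun q => V q m) p v = fderiv ℝ V p v m := by
    intro m v
    have : HasFDerivAt (fun q => V q m)
        ((EuclideanSpace.proj (𝕜 := ℝ) m).comp (fderiv ℝ V p)) p :=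
      (EuclideanSpace.proj (𝕜 := ℝ) m).hasFDerivAt.comp p hVd.hasFDerivAt
    rw [this.fderiv]
    rfl
  -- the derivatives of `θ`
  have hθX : ∀ i j, dX j (θ i) p y = fderiv ℝ (fun q => lower F V i q y) p (e j) := by
    intro i j
    have : (fun q => θ i q y) =ᶠ[nhds p] fun q => lower F V i q y := by
      filter_upwards [hT.mem_nhds hp] with q hq using hθ i q hq y hy
    simp only [dX, this.fderiv_eq]
  have hθY : ∀ i k, dY k (θ i) p y = ∑ m, dY k (fun q z => fund F q z i m) p y * V p m := by
    intro i k
    have : (fun z => θ i p z) =ᶠ[nhds y] fun z => lower F V i p z := by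
      filter_upwards [isOpen_compl_singleton.mem_nhds hy] with z hz using hθ i p hp z hz
    simp only [dY, this.fderiv_eq]
    have hd : ∀ m, DifferentiableAt ℝ (fun z => fund F p z i m) y := fun m =>
      ((smoothOff_fund hT hf i m).hasFDerivAt_right hT hp hy).differentiableAt
    simp only [lower]
    rw [fderiv_fun_sum fun m _ => (hd m).mul_const _]
    simp [fderiv_mul_const (hd _), mul_comm]
  have t1 : ∀ j, ∑ i, y i * dX j (θ i) p y
      = ∑ m, (1 / 2) * (dX j (dY m (sqr F)) p y * V p m
        + dY m (sqr F) p y * fderiv ℝ V p (e j) m) := by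
    intro j
    have hdl : ∀ i, DifferentiableAt ℝ (fun q => lower F V i q y) p := by
      intro i
      simp only [lower]
      refine DifferentiableAt.fun_sum fun m _ => ?_
      exact ((smoothOff_fund hT hf i m).hasFDerivAt_left hT hp hy).differentiableAt.mul (hVm m)
    have ha : ∑ i, y i * dX j (θ i) p y
        = fderiv ℝ (fun q => ∑ i, y i * lower F V i q y) p (e j) := by
      rw [fderiv_fun_sum fun i _ => (hdl i).const_mul _]
      simp [fderiv_const_mul (hdl _), hθX]
    rw [ha]
    have hb : (fun q => ∑ i, y i * lower F V i q y) =ᶠ[nhds p]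
        fun q => ∑ m, (1 / 2 : ℝ) * (dY m (sqr F) q y * V q m) := by
      filter_upwards [hT.mem_nhds hp] with q hq
      simp only [lower, Finset.mul_sum]
      rw [Finset.sum_comm]
      refine Finset.sum_congr rfl fun m _ => ?_
      rw [← mul_assoc, ← hfy q hq y hy m, Finset.sum_mul]
      refine Finset.sum_congr rfl fun i _ => by ring
    have hd : ∀ m, DifferentiableAt ℝ (fun q => dY m (sqr F) q y) p := fun m =>
      ((hf.dY hT m).hasFDerivAt_left hT hp hy).differentiableAt
    rw [hb.fderiv_eq, fderiv_fun_sum fun m _ => ((hd m).fun_mul (hVm m)).const_mul _]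
    simp only [sum_apply]
    refine Finset.sum_congr rfl fun m _ => ?_
    rw [fderiv_const_mul ((hd m).fun_mul (hVm m)), fderiv_fun_mul (hd m) (hVm m)]
    simp only [add_apply, smul_apply, smul_eq_mul, hVe, dX]
    ring
  have t2 : ∑ i, ∑ j, (∑ k, nonlin F k j p y * dY k (θ i) p y) * y i * y j = 0 := by
    have : ∀ k, ∑ i, y i * dY k (θ i) p y = 0 := by
      intro k
      simp only [hθY, Finset.mul_sum]
      rw [Finset.sum_comm]
      refine Finset.sum_eq_zero fun m _ => ?_
      simp only [← mul_assoc, ← Finset.sum_mul, hdf0, zero_mul]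
    calc _ = ∑ k, (∑ j, y j * nonlin F k j p y) * ∑ i, y i * dY k (θ i) p y := by
          simp only [Finset.sum_mul, Finset.mul_sum]
          rw [Finset.sum_comm]
          rw [Finset.sum_congr rfl fun j _ => Finset.sum_comm, Finset.sum_comm]
          refine Finset.sum_congr rfl fun k _ => ?_
          rw [Finset.sum_comm]
          refine Finset.sum_congr rfl fun j _ => ?_
          refine Finset.sum_congr rfl fun i _ => ?_
          ring
      _ = 0 := by simp [this]
  have t3 : ∑ i, ∑ j, (∑ k, berwald F k i j p y * θ k p y) * y i * y j
      = ∑ m, (1 / 2) * V p m * ((∑ k, dX k (dY m (sqr F)) p y * y k) - dX m (sqr F) p y) := by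
    calc _ = ∑ k, (∑ i, y i * ∑ j, y j * berwald F k i j p y) * θ k p y := by
          simp only [Finset.sum_mul, Finset.mul_sum]
          rw [Finset.sum_congr rfl fun i _ => Finset.sum_comm, Finset.sum_comm]
          refine Finset.sum_congr rfl fun k _ => ?_
          refine Finset.sum_congr rfl fun i _ => ?_
          refine Finset.sum_congr rfl fun j _ => ?_
          ring
      _ = ∑ m, 2 * V p m * ∑ k, fund F p y m k * spray F k p y := by
          simp only [hB, hN]
          rw [Finset.sum_congr rfl fun k _ => by rw [hθ k p hp y hy]]
          simp only [lower, Finset.mul_sum]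
          rw [Finset.sum_comm]
          refine Finset.sum_congr rfl fun m _ => ?_
          refine Finset.sum_congr rfl fun k _ => ?_
          rw [fund_symm hT hf hp hy m k]
          ring
      _ = _ := by
          refine Finset.sum_congr rfl fun m _ => ?_
          rw [sum_fund_mul_spray hdet hp hy m]
          ring
  have hsplit : hcov00 F θ p y = ∑ j, y j * (∑ i, y i * dX j (θ i) p y)
      - ∑ i, ∑ j, (∑ k, nonlin F k j p y * dY k (θ i) p y) * y i * y j
      - ∑ i, ∑ j, (∑ k, berwald F k i j p y * θ k p y) * y i * y j := by
    simp only [hcov00, hcov, sub_mul, Finset.sum_sub_distrib, Finset.mul_sum]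
    congr 2
    rw [Finset.sum_comm]
    refine Finset.sum_congr rfl fun j _ => ?_
    refine Finset.sum_congr rfl fun i _ => ?_
    ring
  have hx : fderiv ℝ (fun q => sqr F q y) p (V p) = ∑ m, V p m * dX m (sqr F) p y :=
    (sum_mul_apply_e _ _).symm
  have hyy : fderiv ℝ (fun z => sqr F p z) y (fderiv ℝ V p y)
      = ∑ m, fderiv ℝ V p y m * dY m (sqr F) p y := (sum_mul_apply_e _ _).symm
  have hVy : ∀ m, fderiv ℝ V p y m = ∑ j, y j * fderiv ℝ V p (e j) m := by
    intro m
    exact (sum_mul_apply_e ((EuclideanSpace.proj (𝕜 := ℝ) m).comp (fderiv ℝ V p)) y).symm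
  rw [hsplit, t2, t3, hx, hyy]
  simp only [t1, hVy, Finset.mul_sum, Finset.sum_mul, mul_add, mul_sub, Finset.sum_add_distrib,
    Finset.sum_sub_distrib]
  have c1 : ∑ j, ∑ m, y j * (1 / 2 * (dX j (dY m (sqr F)) p y * V p m))
      = ∑ m, ∑ k, 1 / 2 * V p m * (dX k (dY m (sqr F)) p y * y k) := by
    rw [Finset.sum_comm]
    exact Finset.sum_congr rfl fun m _ => Finset.sum_congr rfl fun k _ => by ring
  have c2 : ∑ j, ∑ m, y j * (1 / 2 * (dY m (sqr F) p y * fderiv ℝ V p (e j) m))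
      = ∑ m, ∑ j, 1 / 2 * (y j * fderiv ℝ V p (e j) m * dY m (sqr F) p y) := by
    rw [Finset.sum_comm]
    exact Finset.sum_congr rfl fun m _ => Finset.sum_congr rfl fun k _ => by ring
  have c3 : ∑ m, 1 / 2 * V p m * dX m (sqr F) p y = ∑ m, 1 / 2 * (V p m * dX m (sqr F) p y) :=
    Finset.sum_congr rfl fun m _ => by ring
  rw [c1, c2, c3]
  ring

end Spray

end Calculus

/-! ### The conformal equation at one point -/

section Pointwise

open Set Filter Topology

/-- The differential equation `q s (φ - s φ') + l φ' = 0` with `φ(0) = 1` and `φ > 0` forces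
`φ² = 1 + k s²`, unless both coefficients vanish. -/
theorem sq_eq_of_ode {φ : ℝ → ℝ} {r q l : ℝ} (hr : 0 < r)
    (hd : ∀ s ∈ Icc (-r) r, DifferentiableAt ℝ φ s) (hc : ContinuousAt (deriv φ) 0)
    (hpos : ∀ s ∈ Icc (-r) r, 0 < φ s) (h0 : φ 0 = 1)
    (hode : ∀ s ∈ Ioo (-r) r, s ≠ 0 → q * s * (φ s - s * deriv φ s) + l * deriv φ s = 0) :
    (q = 0 ∧ l = 0) ∨ ∃ k : ℝ, ∀ s ∈ Icc (-r) r, φ s ^ 2 = 1 + k * s ^ 2 := by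
  have hIoo : Ioo (-r) r ∈ 𝓝 (0 : ℝ) := Ioo_mem_nhds (by linarith) hr
  have hφ0 : ContinuousAt φ 0 := (hd 0 ⟨by linarith, hr.le⟩).continuousAt
  by_cases hl : l = 0
  · by_cases hq : q = 0
    · exact Or.inl ⟨hq, hl⟩
    · -- here `φ = s φ'` off `0`, which contradicts `φ 0 = 1` in the limit
      exfalso
      have h1 : Tendsto (fun s => φ s - s * deriv φ s) (𝓝[≠] 0) (𝓝 (φ 0 - 0 * deriv φ 0)) :=
        (hφ0.sub (continuousAt_id.mul hc)).tendsto.mono_left nhdsWithin_le_nhds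
      have h2 : Tendsto (fun s => φ s - s * deriv φ s) (𝓝[≠] 0) (𝓝 0) := by
        refine tendsto_const_nhds.congr' ?_
        filter_upwards [nhdsWithin_le_nhds hIoo, self_mem_nhdsWithin] with s hs hs0
        have := hode s hs hs0
        rw [hl, zero_mul, add_zero] at this
        exact ((mul_eq_zero.1 this).resolve_left (mul_ne_zero hq hs0)).symm
      have := tendsto_nhds_unique h1 h2
      simp [h0] at this
  · right
    have hode' : ∀ s ∈ Ioo (-r) r, q * s * (φ s - s * deriv φ s) + l * deriv φ s = 0 := by
      intro s hs
      by_cases hs0 : s = 0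
      · subst hs0
        have h1 : Tendsto (fun s => q * s * (φ s - s * deriv φ s) + l * deriv φ s) (𝓝[≠] 0)
            (𝓝 (q * 0 * (φ 0 - 0 * deriv φ 0) + l * deriv φ 0)) :=
          (((continuousAt_const.mul continuousAt_id).mul
            (hφ0.sub (continuousAt_id.mul hc))).add
            (continuousAt_const.mul hc)).tendsto.mono_left nhdsWithin_le_nhds
        have h2 : Tendsto (fun s => q * s * (φ s - s * deriv φ s) + l * deriv φ s) (𝓝[≠] 0)
            (𝓝 0) := by
          refine tendsto_const_nhds.congr' ?_
          filter_upwards [nhdsWithin_le_nhds hIoo, self_mem_nhdsWithin] with s hs hs0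
          exact (hode s hs hs0).symm
        exact tendsto_nhds_unique h1 h2
      · exact hode s hs hs0
    have hne : ∀ s ∈ Ioo (-r) r, l - q * s ^ 2 ≠ 0 := by
      intro s hs h
      have h1 := hode' s hs
      have h2 : q * s * φ s = 0 := by linear_combination h1 - deriv φ s * h
      have h3 := (mul_eq_zero.1 h2).resolve_right (hpos s (Ioo_subset_Icc_self hs)).ne'
      apply hl
      linear_combination h + s * h3
    have hder : ∀ s ∈ Ioo (-r) r, HasDerivAt (fun s => φ s ^ 2 / (l - q * s ^ 2)) 0 s := by
      intro s hs
      have h1 := ((hd s (Ioo_subset_Icc_self hs)).hasDerivAt.pow 2).div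
        (((hasDerivAt_pow 2 s).const_mul q).const_sub l) (hne s hs)
      refine h1.congr_deriv ?_
      rw [div_eq_zero_iff]
      left
      simp only [Pi.pow_apply]
      push_cast
      linear_combination (2 * φ s) * hode' s hs
    have hconst : ∀ s ∈ Ioo (-r) r, φ s ^ 2 = 1 + (-q / l) * s ^ 2 := by
      intro s hs
      have := isOpen_Ioo.is_const_of_deriv_eq_zero isPreconnected_Ioo
        (fun s hs => (hder s hs).differentiableAt.differentiableWithinAt)
        (fun s hs => (hder s hs).deriv) hs (show (0 : ℝ) ∈ Ioo (-r) r from ⟨by linarith, hr⟩)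
      simp only [h0] at this
      rw [div_eq_div_iff (hne s hs) (by simpa using hl)] at this
      field_simp
      linear_combination this
    refine ⟨-q / l, ?_⟩
    have hcl : closure (Ioo (-r) r) = Icc (-r) r := closure_Ioo (by linarith)
    have : EqOn (fun s => φ s ^ 2) (fun s => 1 + (-q / l) * s ^ 2) (Icc (-r) r) := by
      refine EqOn.of_subset_closure (s := Ioo (-r) r) hconst ?_ ?_ Ioo_subset_Icc_self hcl.ge
      · exact fun s hs => ((hd s hs).continuousAt.pow 2).continuousWithinAt
      · fun_prop
    exact this

variable {E : Type*} [NormedAddCommGroup E] [NormedSpace ℝ E] [FiniteDimensional ℝ E]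

theorem exists_ne_zero_apply_eq_zero (hn : 2 ≤ Module.finrank ℝ E) (b : E →L[ℝ] ℝ) :
    ∃ y, y ≠ 0 ∧ b y = 0 := by
  have h : LinearMap.ker b.toLinearMap ≠ ⊥ :=
    LinearMap.ker_ne_bot_of_finrank_lt (by rw [Module.finrank_self]; omega)
  obtain ⟨y, hy, hy0⟩ := (Submodule.ne_bot_iff _).1 h
  exact ⟨y, hy0, hy⟩

/-- The form taken at one point by the condition that a vector field `V` is conformal for
`F = α φ(β/α)`, where `Q` and `L` measure the failure of `V` to scale `α²` and `β` as it should.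
Either there is no failure, or `F² = α² + k β²` at that point. -/
theorem eq_zero_or_sq_eq (hn : 2 ≤ Module.finrank ℝ E) {a Q : E →L[ℝ] E →L[ℝ] ℝ}
    {b L : E →L[ℝ] ℝ} {φ : ℝ → ℝ} (hsymm : ∀ y z, a y z = a z y) (hpd : ∀ y, y ≠ 0 → 0 < a y y)
    (hQ : ∀ y z, Q y z = Q z y) {m : E} (hm : ∀ y, a m y = b y) (hb : b ≠ 0)
    (hd : ∀ y, y ≠ 0 → DifferentiableAt ℝ φ (b y / √(a y y)))
    (hc : ContinuousAt (deriv φ) 0)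
    (hpos : ∀ y, y ≠ 0 → 0 < φ (b y / √(a y y))) (h0 : φ 0 = 1)
    (h : ∀ y, y ≠ 0 → Q y y * (φ (b y / √(a y y)) - b y / √(a y y) * deriv φ (b y / √(a y y)))
      + 2 * √(a y y) * deriv φ (b y / √(a y y)) * L y = 0) :
    (Q = 0 ∧ L = 0) ∨ ∃ r > 0, ∃ k : ℝ, (∀ s ∈ Icc (-r) r, φ s ^ 2 = 1 + k * s ^ 2 ∧ 0 < φ s) ∧
      ∀ y, y ≠ 0 → b y / √(a y y) ∈ Icc (-r) r := by
  have hm0 : m ≠ 0 := by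
    rintro rfl
    exact hb (ContinuousLinearMap.ext fun y => by rw [← hm y]; simp)
  have hbb : 0 < b m := by rw [← hm m]; exact hpd m hm0
  set B := b m with hB
  set r := √B with hr
  have hr0 : 0 < r := Real.sqrt_pos.2 hbb
  have hrr : r ^ 2 = B := Real.sq_sqrt hbb.le
  have hamm : a m m = B := hm m
  -- unit vectors with prescribed value of `b`
  have hvec : ∀ e, b e = 0 → a e e = 1 → ∀ s ∈ Icc (-r) r, ∀ κ, κ ^ 2 = 1 - s ^ 2 / B →
      b ((s / B) • m + κ • e) = s ∧ a ((s / B) • m + κ • e) ((s / B) • m + κ • e) = 1 := by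
    intro e he hae s hs κ hκ
    have h1 : a m e = 0 := by rw [hm, he]
    have h2 : a e m = 0 := by rw [hsymm, h1]
    constructor
    · simp [he, ← hB]
      field_simp
    · simp [hae, h1, h2, hamm]
      field_simp
      field_simp at hκ
      linear_combination hκ
  have hne : ∀ y, a y y = 1 → y ≠ 0 := by
    rintro y hy rfl
    simp at hy
  obtain ⟨e₀, he₀, hbe₀⟩ := exists_ne_zero_apply_eq_zero hn b
  have hunit : ∀ e, e ≠ 0 → a ((√(a e e))⁻¹ • e) ((√(a e e))⁻¹ • e) = 1 := by
    intro e he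
    have h1 := hpd e he
    have h2 : √(a e e) ≠ 0 := (Real.sqrt_pos.2 h1).ne'
    have h3 := Real.sq_sqrt h1.le
    simp
    field_simp
    exact h3.symm
  have hκs : ∀ s ∈ Icc (-r) r, 0 ≤ 1 - s ^ 2 / B := by
    intro s hs
    have : s ^ 2 ≤ B := by rw [← hrr]; exact sq_le_sq' hs.1 hs.2
    have := (div_le_one hbb).2 this
    linarith
  have hval : ∀ s ∈ Icc (-r) r, ∃ y, y ≠ 0 ∧ b y / √(a y y) = s := by
    intro s hs
    obtain ⟨h1, h2⟩ := hvec ((√(a e₀ e₀))⁻¹ • e₀) (by simp [hbe₀]) (hunit e₀ he₀) s hs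
      (√(1 - s ^ 2 / B)) (Real.sq_sqrt (hκs s hs))
    exact ⟨_, hne _ h2, by rw [h1, h2]; simp⟩
  have hd' : ∀ s ∈ Icc (-r) r, DifferentiableAt ℝ φ s := by
    intro s hs
    obtain ⟨y, hy, rfl⟩ := hval s hs
    exact hd y hy
  have hpos' : ∀ s ∈ Icc (-r) r, 0 < φ s := by
    intro s hs
    obtain ⟨y, hy, rfl⟩ := hval s hs
    exact hpos y hy
  have hdec : ∀ y, ∃ e, b e = 0 ∧ y = (b y / B) • m + e := fun y =>
    ⟨y - (b y / B) • m, by simp [← hB]; field_simp; ring, by abel⟩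
  by_cases hk : ∃ k : ℝ, ∀ s ∈ Icc (-r) r, φ s ^ 2 = 1 + k * s ^ 2
  · right
    obtain ⟨k, hk⟩ := hk
    refine ⟨r, hr0, k, fun s hs => ⟨hk s hs, hpos' s hs⟩, fun y hy => ?_⟩
    -- the Cauchy-Schwarz inequality for `b` and `y`
    rw [mem_Icc, ← abs_le]
    refine abs_le_of_sq_le_sq ?_ hr0.le
    rw [div_pow, Real.sq_sqrt (hpd y hy).le, hrr, div_le_iff₀ (hpd y hy)]
    obtain ⟨e, he, hye⟩ := hdec y
    have h1 : a m e = 0 := by rw [hm, he]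
    have h2 : a e m = 0 := by rw [hsymm, h1]
    have h3 : a y y = (b y / B) ^ 2 * B + a e e := by
      conv_lhs => rw [hye]
      simp [h1, h2, hamm]
      ring
    have h4 : 0 ≤ a e e := by
      by_cases h : e = 0
      · simp [h]
      · exact (hpd e h).le
    rw [h3]
    have h5 : B * ((b y / B) ^ 2 * B + a e e) = b y ^ 2 + B * a e e := by
      field_simp
    rw [h5]
    nlinarith [mul_nonneg hbb.le h4]
  · left
    have hkey : ∀ e, b e = 0 → a e e = 1 →
        Q e e = 0 ∧ Q m m = 0 ∧ Q m e = 0 ∧ L m = 0 ∧ L e = 0 := by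
      intro e he hae
      -- the equation at `(s / B) m ± κ e`, split into its parts even and odd in `e`
      have hpm : ∀ s ∈ Ioo (-r) r,
          ((s / B) ^ 2 * Q m m + (1 - s ^ 2 / B) * Q e e) * (φ s - s * deriv φ s)
            + 2 * deriv φ s * ((s / B) * L m) = 0 ∧
          2 * (s / B) * Q m e * (φ s - s * deriv φ s) + 2 * deriv φ s * L e = 0 := by
        intro s hs
        have hs' := Ioo_subset_Icc_self hs
        set κ := √(1 - s ^ 2 / B) with hκdef
        have hκ2 : κ ^ 2 = 1 - s ^ 2 / B := Real.sq_sqrt (hκs s hs')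
        have hκ0 : κ ≠ 0 := by
          have : s ^ 2 < B := by rw [← hrr]; exact sq_lt_sq' hs.1 hs.2
          have := (div_lt_one hbb).2 this
          exact (Real.sqrt_pos.2 (by linarith)).ne'
        obtain ⟨p1, p2⟩ := hvec e he hae s hs' κ hκ2
        obtain ⟨q1, q2⟩ := hvec e he hae s hs' (-κ) (by rw [neg_sq, hκ2])
        have e1 := h _ (hne _ p2)
        have e2 := h _ (hne _ q2)
        rw [p1, p2] at e1
        rw [q1, q2] at e2
        have hQem : Q e m = Q m e := hQ e m
        simp [hQem] at e1 e2
        rw [← hκ2]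
        constructor
        · linear_combination (e1 + e2) / 2
        · refine mul_left_cancel₀ hκ0 ?_
          linear_combination (e1 - e2) / 2
      have hee : Q e e = 0 := by
        have := (hpm 0 ⟨by linarith, hr0⟩).1
        simpa [h0] using this
      have h1 := (sq_eq_of_ode (q := Q m m) (l := 2 * B * L m) hr0 hd' hc hpos' h0 (by
        intro s hs hs0
        have := (hpm s hs).1
        rw [hee] at this
        refine mul_left_cancel₀ hs0 ?_
        field_simp at this
        linear_combination this)).resolve_right hk
      have h2 := (sq_eq_of_ode (q := Q m e) (l := B * L e) hr0 hd' hc hpos' h0 (by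
        intro s hs hs0
        have := (hpm s hs).2
        field_simp at this
        linear_combination this / 2)).resolve_right hk
      refine ⟨hee, h1.1, h2.1, ?_, ?_⟩
      · simpa [hbb.ne'] using h1.2
      · simpa [hbb.ne'] using h2.2
    have hkey' : ∀ e, b e = 0 → Q e e = 0 ∧ Q m e = 0 ∧ L e = 0 := by
      intro e he
      by_cases he0 : e = 0
      · simp [he0]
      · obtain ⟨h1, -, h3, -, h5⟩ := hkey _ (by simp [he]) (hunit e he0)
        have : √(a e e) ≠ 0 := (Real.sqrt_pos.2 (hpd e he0)).ne'
        simp [this] at h1 h3 h5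
        exact ⟨h1, h3, h5⟩
    obtain ⟨-, hmm, -, hLm, -⟩ := hkey ((√(a e₀ e₀))⁻¹ • e₀) (by simp [hbe₀]) (hunit e₀ he₀)
    have hQyy : ∀ y, Q y y = 0 := by
      intro y
      obtain ⟨e, he, hye⟩ := hdec y
      obtain ⟨h1, h2, -⟩ := hkey' e he
      rw [hye]
      simp [hmm, h1, h2, hQ e m]
    constructor
    · ext y z
      have := hQyy (y + z)
      simp [hQyy y, hQyy z, hQ z y] at this
      simpa using this
    · ext y
      obtain ⟨e, he, hye⟩ := hdec y
      rw [hye]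
      simp [hLm, (hkey' e he).2.2]

end Pointwise

/-! ### Lie derivatives of metrics and 1-forms -/

section Lie

open Set Filter Topology

variable {E : Type*} [NormedAddCommGroup E] [NormedSpace ℝ E]

/-- A smooth Riemannian metric on a subset `T` of a vector space. -/
structure IsMetricOn (T : Set E) (A : E → E →L[ℝ] E →L[ℝ] ℝ) : Prop where
  contDiffOn : ContDiffOn ℝ ∞ A T
  symm : ∀ p ∈ T, ∀ y z, A p y z = A p z y
  pos : ∀ p ∈ T, ∀ y, y ≠ 0 → 0 < A p y y

/-- The Lie derivative along `V` of a field of bilinear forms. -/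
def lieBilin (V : E → E) (A : E → E →L[ℝ] E →L[ℝ] ℝ) (p : E) : E →L[ℝ] E →L[ℝ] ℝ :=
  fderiv ℝ A p (V p) + (A p).comp (fderiv ℝ V p) + ((A p).flip.comp (fderiv ℝ V p)).flip

/-- The Lie derivative along `V` of a 1-form. -/
def lieForm (V : E → E) (B : E → E →L[ℝ] ℝ) (p : E) : E →L[ℝ] ℝ :=
  fderiv ℝ B p (V p) + (B p).comp (fderiv ℝ V p)

theorem lieBilin_apply (V : E → E) (A : E → E →L[ℝ] E →L[ℝ] ℝ) (p y z : E) :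
    lieBilin V A p y z
      = fderiv ℝ A p (V p) y z + A p (fderiv ℝ V p y) z + A p y (fderiv ℝ V p z) := by
  simp [lieBilin]

theorem lieForm_apply (V : E → E) (B : E → E →L[ℝ] ℝ) (p y : E) :
    lieForm V B p y = fderiv ℝ B p (V p) y + B p (fderiv ℝ V p y) := by
  simp [lieForm]

variable {T : Set E} {V : E → E} {A H : E → E →L[ℝ] E →L[ℝ] ℝ} {B : E → E →L[ℝ] ℝ} {p : E}

theorem hasFDerivAt_apply {B : E → E →L[ℝ] ℝ} (hB : DifferentiableAt ℝ B p) (y : E) :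
    HasFDerivAt (fun q => B q y) ((fderiv ℝ B p).flip y) p := by
  refine (hB.hasFDerivAt.clm_apply (hasFDerivAt_const y p)).congr_fderiv ?_
  ext v
  simp

theorem hasFDerivAt_apply_apply (hA : DifferentiableAt ℝ A p) (y z : E) :
    HasFDerivAt (fun q => A q y z)
      (((ContinuousLinearMap.apply ℝ ℝ z).comp ((fderiv ℝ A p).flip y))) p := by
  have h1 : HasFDerivAt (fun q => A q y) ((fderiv ℝ A p).flip y) p := by
    refine (hA.hasFDerivAt.clm_apply (hasFDerivAt_const y p)).congr_fderiv ?_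
    ext v
    simp
  refine (h1.clm_apply (hasFDerivAt_const z p)).congr_fderiv ?_
  ext v
  simp

namespace IsMetricOn

theorem differentiableAt (hA : IsMetricOn T A) (hT : IsOpen T) (hp : p ∈ T) :
    DifferentiableAt ℝ A p :=
  (hA.contDiffOn.contDiffAt (hT.mem_nhds hp)).differentiableAt (by simp)

theorem fderiv_symm (hA : IsMetricOn T A) (hT : IsOpen T) (hp : p ∈ T) (v y z : E) :
    fderiv ℝ A p v y z = fderiv ℝ A p v z y := by
  have h1 := hasFDerivAt_apply_apply (hA.differentiableAt hT hp) y z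
  have h2 := hasFDerivAt_apply_apply (hA.differentiableAt hT hp) z y
  have h3 := h1.unique (h2.congr_of_eventuallyEq (by
    filter_upwards [hT.mem_nhds hp] with q hq using hA.symm q hq y z))
  simpa using congrArg (fun L => L v) h3

theorem lieBilin_symm (hA : IsMetricOn T A) (hT : IsOpen T) (hp : p ∈ T) (y z : E) :
    lieBilin V A p y z = lieBilin V A p z y := by
  rw [lieBilin_apply, lieBilin_apply, hA.fderiv_symm hT hp, hA.symm p hp _ z, hA.symm p hp y]
  ring

theorem eq_zero_of_forall (hA : IsMetricOn T A) (hp : p ∈ T) {y : E} (h : ∀ z, A p y z = 0) :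
    y = 0 := by
  by_contra hy
  exact (hA.pos p hp y hy).ne' (h y)

theorem isInvertible [FiniteDimensional ℝ E] (hA : IsMetricOn T A) (hp : p ∈ T) :
    (A p).IsInvertible := by
  have hinj : Function.Injective (A p).toLinearMap := by
    rw [injective_iff_map_eq_zero]
    exact fun y hy => hA.eq_zero_of_forall hp fun z => congrArg (fun L => L z) hy
  have hfin : Module.finrank ℝ E = Module.finrank ℝ (E →L[ℝ] ℝ) := by
    rw [← (LinearMap.toContinuousLinearMap (𝕜 := ℝ) (E := E) (F' := ℝ)).finrank_eq]
    exact (Subspace.dual_finrank_eq (K := ℝ) (V := E)).symm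
  refine ⟨(LinearEquiv.ofInjectiveOfFinrankEq (A p).toLinearMap hinj hfin).toContinuousLinearEquiv,
    ?_⟩
  ext y
  rfl

/-- The vector field dual to a 1-form. -/
theorem exists_dual [FiniteDimensional ℝ E] (hA : IsMetricOn T A) (hB : ContDiffOn ℝ ∞ B T) :
    ∃ m : E → E, ContDiffOn ℝ ∞ m T ∧ ∀ p ∈ T, ∀ y, A p (m p) y = B p y := by
  refine ⟨fun p => (A p).inverse (B p), ?_, ?_⟩
  · refine ContDiffOn.clm_apply (fun p hp => ?_) hB
    exact (hA.isInvertible hp).contDiffAt_map_inverse.comp_contDiffWithinAt p (hA.contDiffOn p hp)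
  · intro p hp y
    rw [(hA.isInvertible hp).self_apply_inverse]

end IsMetricOn

/-- If `V` scales a metric and a 1-form compatibly, it scales the dual vector field. -/
theorem fderiv_dual_sub (hT : IsOpen T) (hA : IsMetricOn T A) (hp : p ∈ T)
    {m : E → E} (hm : DifferentiableAt ℝ m p) (hmB : ∀ q ∈ T, ∀ y, A q (m q) y = B q y) {c : ℝ}
    (hB : DifferentiableAt ℝ B p)
    (hLA : lieBilin V A p = (-4 * c) • A p) (hLB : lieForm V B p = (-2 * c) • B p) :
    fderiv ℝ m p (V p) - fderiv ℝ V p (m p) = (2 * c) • m p := by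
  rw [← sub_eq_zero]
  refine hA.eq_zero_of_forall hp fun y => ?_
  have h1 : HasFDerivAt (fun q => A q (m q) y) _ p :=
    ((hA.differentiableAt hT hp).hasFDerivAt.clm_apply hm.hasFDerivAt).clm_apply
      (hasFDerivAt_const y p)
  have h2 := (hasFDerivAt_apply hB y).congr_of_eventuallyEq (f₁ := fun q => A q (m q) y) (by
    filter_upwards [hT.mem_nhds hp] with q hq using hmB q hq y)
  have h3 := congrArg (fun L => L (V p)) (h1.unique h2)
  have h4 := congrArg (fun L => L (m p) y) hLA
  have h5 := congrArg (fun L => L y) hLB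
  simp [lieBilin_apply, lieForm_apply, hmB p hp] at h3 h4 h5
  simp [hmB p hp]
  linarith

/-- If `V` scales a metric and a 1-form compatibly, it preserves the norm of the 1-form. -/
theorem fderiv_apply_dual_eq_zero (hT : IsOpen T) (hA : IsMetricOn T A) (hp : p ∈ T)
    {m : E → E} (hm : DifferentiableAt ℝ m p) (hmB : ∀ q ∈ T, ∀ y, A q (m q) y = B q y) {c : ℝ}
    (hB : DifferentiableAt ℝ B p)
    (hLA : lieBilin V A p = (-4 * c) • A p) (hLB : lieForm V B p = (-2 * c) • B p) :
    fderiv ℝ (fun q => B q (m q)) p (V p) = 0 := by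
  have h1 := fderiv_dual_sub hT hA hp hm hmB hB hLA hLB
  rw [fderiv_clm_apply hB hm]
  have h2 := congrArg (fun L => L (m p)) hLB
  have h3 := congrArg (fun v => B p v) h1
  simp [lieForm_apply] at h2 h3 ⊢
  linarith

/-- A deformation of the metric by functions of an invariant of `V` scales like the metric. -/
theorem lieBilin_deformation (hT : IsOpen T) (hA : IsMetricOn T A) (hH : IsMetricOn T H)
    (hp : p ∈ T) {c : ℝ} (hB : DifferentiableAt ℝ B p)
    (hLA : lieBilin V A p = (-4 * c) • A p) (hLB : lieForm V B p = (-2 * c) • B p)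
    {f g : E → ℝ} (hf : DifferentiableAt ℝ f p) (hg : DifferentiableAt ℝ g p)
    (hf0 : fderiv ℝ f p (V p) = 0) (hg0 : fderiv ℝ g p (V p) = 0)
    (hHA : ∀ q ∈ T, ∀ y z, H q y z = f q * A q y z + g q * (B q y * B q z)) :
    lieBilin V H p = (-4 * c) • H p := by
  ext y z
  have h1 : HasFDerivAt (fun q => f q * A q y z + g q * (B q y * B q z)) _ p :=
    (hf.hasFDerivAt.mul (hasFDerivAt_apply_apply (hA.differentiableAt hT hp) y z)).add
      (hg.hasFDerivAt.mul ((hasFDerivAt_apply hB y).mul (hasFDerivAt_apply hB z)))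
  have h2 := (hasFDerivAt_apply_apply (hH.differentiableAt hT hp) y z).congr_of_eventuallyEq
    (f₁ := fun q => f q * A q y z + g q * (B q y * B q z)) (by
      filter_upwards [hT.mem_nhds hp] with q hq using (hHA q hq y z).symm)
  have h3 := congrArg (fun L => L (V p)) (h2.unique h1)
  have h4 := congrArg (fun L => L y z) hLA
  have h5 := congrArg (fun L => L y) hLB
  have h6 := congrArg (fun L => L z) hLB
  simp [lieBilin_apply, lieForm_apply, hf0, hg0] at h3 h4 h5 h6
  simp only [lieBilin_apply, h3, hHA p hp, smul_apply, smul_eq_mul]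
  linear_combination f p * h4 + g p * (B p z * h5 + B p y * h6)

theorem lieForm_smul {c : ℝ} (hB : DifferentiableAt ℝ B p)
    (hLB : lieForm V B p = (-2 * c) • B p) {f : E → ℝ} (hf : DifferentiableAt ℝ f p)
    (hf0 : fderiv ℝ f p (V p) = 0) :
    lieForm V (fun q => f q • B q) p = (-2 * c) • (f p • B p) := by
  ext y
  have h5 := congrArg (fun L => L y) hLB
  rw [lieForm_apply, fderiv_fun_smul hf hB]
  simp [lieForm_apply, hf0] at h5 ⊢
  linear_combination f p * h5

/-- The complete lift of a vector field, on pairs (position, direction). -/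
def lift (V : E → E) (z : E × E) : E × E := (V z.1, fderiv ℝ V z.1 z.2)

/-- The squared norm `H p y y` of a metric, as a function of the pair `(p, y)`. -/
def quad (H : E → E →L[ℝ] E →L[ℝ] ℝ) (z : E × E) : ℝ := H z.1 z.2 z.2

theorem contDiffAt_quad (hT : IsOpen T) (hH : IsMetricOn T H) (hp : p ∈ T) (y : E) :
    ContDiffAt ℝ ∞ (quad H) (p, y) := by
  have h1 : ContDiffAt ℝ ∞ H ((p, y) : E × E).1 := hH.contDiffOn.contDiffAt (hT.mem_nhds hp)
  exact ((h1.comp (p, y) contDiffAt_fst).clm_apply contDiffAt_snd).clm_apply contDiffAt_snd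

theorem hasFDerivAt_quad (hH : DifferentiableAt ℝ H p) (y : E) :
    HasFDerivAt (quad H) (((fderiv ℝ H p).flip y).flip y ∘L ContinuousLinearMap.fst ℝ E E
      + (H p y + (H p).flip y) ∘L ContinuousLinearMap.snd ℝ E E) (p, y) := by
  have h1 : HasFDerivAt (fun z : E × E => H z.1) ((fderiv ℝ H p).comp
      (ContinuousLinearMap.fst ℝ E E)) (p, y) :=
    HasFDerivAt.comp (g := H) (g' := fderiv ℝ H p) (f := Prod.fst)
      (f' := ContinuousLinearMap.fst ℝ E E) (p, y) hH.hasFDerivAt hasFDerivAt_fst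
  have h2 : HasFDerivAt (quad H) _ (p, y) :=
    (h1.clm_apply hasFDerivAt_snd).clm_apply hasFDerivAt_snd
  refine h2.congr_fderiv ?_
  ext v <;> simp

theorem fderiv_quad_lift (hH : DifferentiableAt ℝ H p) (y : E) :
    fderiv ℝ (quad H) (p, y) (lift V (p, y)) = lieBilin V H p y y := by
  rw [(hasFDerivAt_quad hH y).fderiv, lieBilin_apply]
  simp [lift]
  ring

theorem hasFDerivAt_lift (hV : DifferentiableAt ℝ V p) (hV' : DifferentiableAt ℝ (fderiv ℝ V) p)
    (y : E) : HasFDerivAt (lift V) ((fderiv ℝ V p ∘L ContinuousLinearMap.fst ℝ E E).prod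
      ((fderiv ℝ (fderiv ℝ V) p).flip y ∘L ContinuousLinearMap.fst ℝ E E
        + fderiv ℝ V p ∘L ContinuousLinearMap.snd ℝ E E)) (p, y) := by
  have h0 : HasFDerivAt (fun z : E × E => V z.1) ((fderiv ℝ V p).comp
      (ContinuousLinearMap.fst ℝ E E)) (p, y) :=
    HasFDerivAt.comp (g := V) (f := Prod.fst) (p, y) hV.hasFDerivAt hasFDerivAt_fst
  have h1 : HasFDerivAt (fun z : E × E => fderiv ℝ V z.1) ((fderiv ℝ (fderiv ℝ V) p).comp
      (ContinuousLinearMap.fst ℝ E E)) (p, y) :=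
    HasFDerivAt.comp (g := fderiv ℝ V) (f := Prod.fst) (p, y) hV'.hasFDerivAt hasFDerivAt_fst
  have h2 := h0.prodMk (h1.clm_apply (hasFDerivAt_snd (𝕜 := ℝ) (p := (p, y))))
  refine h2.congr_fderiv ?_
  ext v <;> simp

/-- If `V` and `X` are conformal fields of a metric `h` with conformal factors `c` and `σ`, and
`[V, X] = 2 c X`, then the product of `dc` with the 1-form dual to `X` is proportional to `h`:
apply the identity of complete lifts `[Vᶜ, Xᶜ] = [V, X]ᶜ` to the square of the norm of `h`. -/
theorem exists_fderiv_mul_eq (hT : IsOpen T) (hH : IsMetricOn T H) {X : E → E} {c σ : E → ℝ}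
    (hV : ContDiffOn ℝ ∞ V T) (hX : ContDiffOn ℝ ∞ X T) (hp : p ∈ T)
    (hc : DifferentiableAt ℝ c p) (hσ : DifferentiableAt ℝ σ p)
    (hVH : ∀ q ∈ T, lieBilin V H q = (-4 * c q) • H q)
    (hXH : ∀ q ∈ T, lieBilin X H q = (-4 * σ q) • H q)
    (hVX : ∀ q ∈ T, fderiv ℝ X q (V q) - fderiv ℝ V q (X q) = (2 * c q) • X q) :
    ∃ μ : ℝ, ∀ y, fderiv ℝ c p y * H p (X p) y = μ * H p y y := by
  have hVa := hV.contDiffAt (hT.mem_nhds hp)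
  have hXa := hX.contDiffAt (hT.mem_nhds hp)
  have hVd := hVa.differentiableAt (by simp)
  have hXd := hXa.differentiableAt (by simp)
  have hVd' : DifferentiableAt ℝ (fderiv ℝ V) p :=
    (hVa.fderiv_right (m := ∞) (by simp)).differentiableAt (by simp)
  have hXd' : DifferentiableAt ℝ (fderiv ℝ X) p :=
    (hXa.fderiv_right (m := ∞) (by simp)).differentiableAt (by simp)
  have hVs : IsSymmSndFDerivAt ℝ V p := hVa.isSymmSndFDerivAt two_le_infty
  have hXs : IsSymmSndFDerivAt ℝ X p := hXa.isSymmSndFDerivAt two_le_infty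
  refine ⟨fderiv ℝ c p (X p) - fderiv ℝ σ p (V p) + 2 * c p * σ p, fun y => ?_⟩
  have hTn : ∀ᶠ z : E × E in 𝓝 (p, y), z.1 ∈ T :=
    continuousAt_fst.eventually (hT.mem_nhds hp)
  have hqa := contDiffAt_quad hT hH hp y
  have hqs : IsSymmSndFDerivAt ℝ (quad H) (p, y) := hqa.isSymmSndFDerivAt two_le_infty
  have hqd : DifferentiableAt ℝ (fderiv ℝ (quad H)) (p, y) :=
    (hqa.fderiv_right (m := ∞) (by simp)).differentiableAt (by simp)
  have hq1 : DifferentiableAt ℝ (quad H) (p, y) := hqa.differentiableAt (by simp)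
  -- derivatives of the functions `Vᶜ(h²)` and `Xᶜ(h²)`
  have hder : ∀ (W : E → E) (τ : E → ℝ), DifferentiableAt ℝ W p →
      DifferentiableAt ℝ (fderiv ℝ W) p → DifferentiableAt ℝ τ p →
      (∀ q ∈ T, lieBilin W H q = (-4 * τ q) • H q) → ∀ u : E × E,
      fderiv ℝ (fderiv ℝ (quad H)) (p, y) u (lift W (p, y))
        + fderiv ℝ (quad H) (p, y) (fderiv ℝ (lift W) (p, y) u)
        = -4 * (fderiv ℝ τ p u.1 * H p y y + τ p * fderiv ℝ (quad H) (p, y) u) := by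
    intro W τ hW hW' hτ hWH u
    have hl := hasFDerivAt_lift hW hW' y
    have h1 := hqd.hasFDerivAt.clm_apply hl
    have h0 : HasFDerivAt (fun z : E × E => τ z.1) ((fderiv ℝ τ p).comp
        (ContinuousLinearMap.fst ℝ E E)) (p, y) :=
      HasFDerivAt.comp (g := τ) (f := Prod.fst) (p, y) hτ.hasFDerivAt hasFDerivAt_fst
    have h2 := (h0.mul hq1.hasFDerivAt).const_mul (-4)
    have h3 : (fun z => fderiv ℝ (quad H) z (lift W z)) =ᶠ[𝓝 (p, y)]
        fun z => -4 * (τ z.1 * quad H z) := by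
      filter_upwards [hTn] with z hz
      have := fderiv_quad_lift (V := W) (hH.differentiableAt hT hz) z.2
      rw [hWH z.1 hz] at this
      simp only [smul_apply, smul_eq_mul] at this
      rw [this, quad]
      ring
    have h4 := congrArg (fun L => L u) (h1.unique (h2.congr_of_eventuallyEq h3))
    rw [hl.fderiv]
    simp [quad] at h4 ⊢
    linear_combination h4
  have e1 := hder X σ hXd hXd' hσ hXH (lift V (p, y))
  have e2 := hder V c hVd hVd' hc hVH (lift X (p, y))
  rw [hqs.eq] at e1
  rw [fderiv_quad_lift (hH.differentiableAt hT hp), hVH p hp] at e1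
  rw [fderiv_quad_lift (hH.differentiableAt hT hp), hXH p hp] at e2
  -- the derivative of `[V, X] = 2 c X`
  have hbr : fderiv ℝ (fderiv ℝ X) p y (V p) + fderiv ℝ X p (fderiv ℝ V p y)
      - (fderiv ℝ (fderiv ℝ V) p y (X p) + fderiv ℝ V p (fderiv ℝ X p y))
      = (2 * fderiv ℝ c p y) • X p + (2 * c p) • fderiv ℝ X p y := by
    have h1 := (hXd'.hasFDerivAt.clm_apply hVd.hasFDerivAt).sub
      (hVd'.hasFDerivAt.clm_apply hXd.hasFDerivAt)
    have h2 := (hc.hasFDerivAt.const_mul 2).smul hXd.hasFDerivAt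
    have h3 := h1.unique (h2.congr_of_eventuallyEq (by
      filter_upwards [hT.mem_nhds hp] with q hq using hVX q hq))
    have h4 := congrArg (fun L => L y) h3
    simp at h4
    rw [add_comm (fderiv ℝ (fderiv ℝ X) p y (V p)), add_comm (fderiv ℝ (fderiv ℝ V) p y (X p)), h4]
    rw [add_comm]
  have hlift : fderiv ℝ (lift X) (p, y) (lift V (p, y)) - fderiv ℝ (lift V) (p, y) (lift X (p, y))
      = (2 * c p) • lift X (p, y) + (0, (2 * fderiv ℝ c p y) • X p) := by
    rw [(hasFDerivAt_lift hVd hVd' y).fderiv, (hasFDerivAt_lift hXd hXd' y).fderiv]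
    refine Prod.ext ?_ ?_
    · simpa [lift] using hVX p hp
    · have hx := hXs.eq (V p) y
      have hv := hVs.eq (X p) y
      simp [lift, hx, hv, hbr]
      abel
  have e3 := congrArg (fun v => fderiv ℝ (quad H) (p, y) v) hlift
  simp only [map_sub, map_add, map_smul] at e3
  rw [fderiv_quad_lift (hH.differentiableAt hT hp), hXH p hp] at e3
  have e4 : fderiv ℝ (quad H) (p, y) (0, (2 * fderiv ℝ c p y) • X p)
      = 4 * (fderiv ℝ c p y * H p (X p) y) := by
    rw [(hasFDerivAt_quad (hH.differentiableAt hT hp) y).fderiv]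
    simp [hH.symm p hp y (X p)]
    ring
  rw [e4] at e3
  simp only [lift, smul_apply, smul_eq_mul] at e1 e2 e3
  linear_combination (e1 - e2 - e3) / 4

/-- A product of linear forms that is a multiple of a definite form vanishes in dimension `≥ 2`. -/
theorem eq_zero_of_mul_eq [FiniteDimensional ℝ E] (hn : 2 ≤ Module.finrank ℝ E)
    {a : E →L[ℝ] E →L[ℝ] ℝ} (hpd : ∀ y, y ≠ 0 → 0 < a y y) {f g : E →L[ℝ] ℝ} {μ : ℝ}
    (h : ∀ y, f y * g y = μ * a y y) (hg : g ≠ 0) : f = 0 := by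
  obtain ⟨z, hz, hgz⟩ := exists_ne_zero_apply_eq_zero hn g
  have hμ : μ = 0 := by
    have := h z
    rw [hgz, mul_zero] at this
    exact (mul_eq_zero.1 this.symm).resolve_right (hpd z hz).ne'
  simp only [hμ, zero_mul] at h
  obtain ⟨w, hw⟩ : ∃ w, g w ≠ 0 := by
    by_contra! hcon
    exact hg (ContinuousLinearMap.ext hcon)
  have hfw : f w = 0 := (mul_eq_zero.1 (h w)).resolve_right hw
  ext y
  have h1 := h (y + w)
  have h2 := h y
  simp only [map_add, hfw, add_zero] at h1
  have h3 : f y * g w = 0 := by linear_combination h1 - h2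
  exact (mul_eq_zero.1 h3).resolve_right hw

end Lie

/-! ### Conformal fields of `α φ(β/α)` in coordinates -/

section Local

open Set Filter Topology

/-- The derivative of `F² = N φ(b / √N)²`. -/
theorem hasFDerivAt_sq_sqrt_mul {G : Type*} [NormedAddCommGroup G] [NormedSpace ℝ G]
    {N b : G → ℝ} {N' b' : G →L[ℝ] ℝ} {x : G} {φ : ℝ → ℝ} (hN : HasFDerivAt N N' x)
    (hb : HasFDerivAt b b' x) (hN0 : 0 < N x) (hφ : DifferentiableAt ℝ φ (b x / √(N x))) :
    HasFDerivAt (fun z => (√(N z) * φ (b z / √(N z))) ^ 2)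
      ((φ (b x / √(N x)) * (φ (b x / √(N x)) - b x / √(N x) * deriv φ (b x / √(N x)))) • N'
        + (2 * √(N x) * φ (b x / √(N x)) * deriv φ (b x / √(N x))) • b') x := by
  have hr := hN.sqrt hN0.ne'
  have hr0 : √(N x) ≠ 0 := (Real.sqrt_pos.2 hN0).ne'
  simp only [div_eq_mul_inv] at hφ ⊢
  have hi : HasFDerivAt (fun z => (√(N z))⁻¹) _ x := (hasDerivAt_inv hr0).comp_hasFDerivAt x hr
  have hs : HasFDerivAt (fun z => b z * (√(N z))⁻¹) _ x := hb.mul hi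
  have h1 := (hr.mul (hφ.hasDerivAt.comp_hasFDerivAt x hs)).pow 2
  refine h1.congr_fderiv ?_
  ext v
  simp
  field_simp
  ring

variable {n : ℕ} {T : Set (Coord n)} {A H : Coord n → Coord n →L[ℝ] Coord n →L[ℝ] ℝ}
  {B : Coord n → Coord n →L[ℝ] ℝ} {V : Coord n → Coord n} {φ : ℝ → ℝ} {S : Set ℝ}
  {c : Coord n → ℝ}

/-- The function `α φ(β/α)` of a metric and a 1-form in coordinates. -/
def abNorm (A : Coord n → Coord n →L[ℝ] Coord n →L[ℝ] ℝ) (B : Coord n → Coord n →L[ℝ] ℝ)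
    (φ : ℝ → ℝ) (p y : Coord n) : ℝ :=
  √(A p y y) * φ (B p y / √(A p y y))

theorem homog_abNorm : Homog 1 (abNorm A B φ) := by
  intro p y t ht
  have h1 : √(A p (t • y) (t • y)) = t * √(A p y y) := by
    simp only [map_smul, smul_apply, smul_eq_mul]
    rw [← mul_assoc, Real.sqrt_mul (mul_self_nonneg t), Real.sqrt_mul_self ht.le]
  simp only [abNorm, h1]
  rw [map_smul, smul_eq_mul, mul_div_mul_left _ _ ht.ne']
  ring

theorem smoothOff_metric (hA : ContDiffOn ℝ ∞ A T) : SmoothOff T (fun p y => A p y y) := by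
  have h1 : ContDiffOn ℝ ∞ (fun z : Coord n × Coord n => A z.1) (T ×ˢ {0}ᶜ) :=
    hA.comp contDiffOn_fst fun z hz => hz.1
  exact (h1.clm_apply contDiffOn_snd).clm_apply contDiffOn_snd

theorem smoothOff_form (hB : ContDiffOn ℝ ∞ B T) : SmoothOff T (fun p y => B p y) := by
  have h1 : ContDiffOn ℝ ∞ (fun z : Coord n × Coord n => B z.1) (T ×ˢ {0}ᶜ) :=
    hB.comp contDiffOn_fst fun z hz => hz.1
  exact h1.clm_apply contDiffOn_snd

theorem smoothOff_sqr_abNorm (hA : IsMetricOn T A) (hB : ContDiffOn ℝ ∞ B T)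
    (hφ : ContDiffOn ℝ ∞ φ S) (hmem : ∀ p ∈ T, ∀ y, y ≠ 0 → B p y / √(A p y y) ∈ S) :
    SmoothOff T (sqr (abNorm A B φ)) := by
  have hα : SmoothOff T (fun p y => √(A p y y)) :=
    ContDiffOn.sqrt (smoothOff_metric hA.contDiffOn) fun z hz => (hA.pos _ hz.1 _ hz.2).ne'
  have hs : SmoothOff T (fun p y => B p y / √(A p y y)) :=
    ContDiffOn.div (smoothOff_form hB) hα fun z hz =>
      (Real.sqrt_pos.2 (hA.pos _ hz.1 _ hz.2)).ne'
  have h1 : SmoothOff T (fun p y => φ (B p y / √(A p y y))) :=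
    ContDiffOn.comp hφ hs fun z hz => hmem _ hz.1 _ hz.2
  exact ContDiffOn.pow (hα.mul h1) 2

/-- A conformal factor is smooth, since `F²` is. -/
theorem contDiffOn_conformalFactor (hn : 0 < n) (hT : IsOpen T) {f : Coord n → Coord n → ℝ}
    (hf : SmoothOff T f) (hf0 : ∀ p ∈ T, ∀ y, y ≠ 0 → f p y ≠ 0) (hV : ContDiffOn ℝ ∞ V T)
    (hc : ∀ p ∈ T, ∀ y, y ≠ 0 → fderiv ℝ (fun q => f q y) p (V p)
      + fderiv ℝ (fun z => f p z) y (fderiv ℝ V p y) = -4 * c p * f p y) :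
    ContDiffOn ℝ ∞ c T := by
  have hy : e (⟨0, hn⟩ : Fin n) ≠ 0 := by
    intro h
    have := congrArg (fun v : Coord n => v ⟨0, hn⟩) h
    simp [e] at this
  set y : Coord n := e ⟨0, hn⟩
  have hpr : ContDiffOn ℝ ∞ (fun p : Coord n => (p, y)) T := by fun_prop
  have hmaps : MapsTo (fun p : Coord n => (p, y)) T (T ×ˢ {0}ᶜ) := fun p hp => ⟨hp, hy⟩
  have h1 := (hf.fderiv_of_isOpen (m := ∞) (isOpen_prod_compl hT) (by simp)).comp hpr hmaps
  have h2 := (hV.fderiv_of_isOpen (m := ∞) hT (by simp)).clm_apply (contDiffOn_const (c := y))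
  have h3 := h1.clm_apply (hV.prodMk h2)
  have h4 : ContDiffOn ℝ ∞ (fun p => f p y) T := ContDiffOn.comp hf hpr hmaps
  refine ((h3.div h4 fun p hp => hf0 p hp y hy).const_smul (-(1 / 4 : ℝ))).congr fun p hp => ?_
  have h5 := hc p hp y hy
  rw [(hf.hasFDerivAt_left hT hp hy).fderiv, (hf.hasFDerivAt_right hT hp hy).fderiv] at h5
  simp only [ContinuousLinearMap.comp_apply, ← map_add, ContinuousLinearMap.inl_apply,
    ContinuousLinearMap.inr_apply, Prod.mk_add_mk, add_zero, zero_add] at h5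
  have := hf0 p hp y hy
  simp only [Function.comp_apply, Pi.div_apply, h5, smul_eq_mul]
  field_simp

/-- A conformal field of a non-Riemannian `F = α φ(β/α)` with conformal factor `c` scales `α²` and
`β`: where it does not, `φ² = 1 + k s²`, with `k` independent of the point, on an open set. -/
theorem lieBilin_eq_and_lieForm_eq (hn : 2 ≤ n) (hT : IsOpen T) (hA : IsMetricOn T A)
    (hB : ContDiffOn ℝ ∞ B T) (hV : ContDiffOn ℝ ∞ V T) (hS : IsOpen S) (hφ : ContDiffOn ℝ ∞ φ S)
    (hmem : ∀ p ∈ T, ∀ y, y ≠ 0 → B p y / √(A p y y) ∈ S)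
    (hpos : ∀ p ∈ T, ∀ y, y ≠ 0 → 0 < φ (B p y / √(A p y y))) (h0 : φ 0 = 1)
    (hφk : ∀ U ⊆ T, IsOpen U → U.Nonempty → ∀ k : ℝ, ∃ p ∈ U, ∃ y, y ≠ 0 ∧
      φ (B p y / √(A p y y)) ≠ √(1 + k * (B p y / √(A p y y)) ^ 2))
    (hcc : ContinuousOn c T)
    (hc : ∀ p ∈ T, ∀ y, y ≠ 0 → fderiv ℝ (fun q => sqr (abNorm A B φ) q y) p (V p)
      + fderiv ℝ (fun z => sqr (abNorm A B φ) p z) y (fderiv ℝ V p y)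
        = -4 * c p * sqr (abNorm A B φ) p y) :
    ∀ p ∈ T, lieBilin V A p = (-4 * c p) • A p ∧ lieForm V B p = (-2 * c p) • B p := by
  have hfin : 2 ≤ Module.finrank ℝ (Coord n) := by simpa using hn
  have hBd : ∀ p ∈ T, DifferentiableAt ℝ B p := fun p hp =>
    (hB.contDiffAt (hT.mem_nhds hp)).differentiableAt (by simp)
  have hφd : ∀ p ∈ T, ∀ y, y ≠ 0 → DifferentiableAt ℝ φ (B p y / √(A p y y)) := fun p hp y hy =>
    (hφ.contDiffAt (hS.mem_nhds (hmem p hp y hy))).differentiableAt (by simp)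
  let Q : Coord n → Coord n →L[ℝ] Coord n →L[ℝ] ℝ := fun p => lieBilin V A p + (4 * c p) • A p
  let L : Coord n → Coord n →L[ℝ] ℝ := fun p => lieForm V B p + (2 * c p) • B p
  suffices hQL : ∀ p ∈ T, Q p = 0 ∧ L p = 0 by
    intro p hp
    obtain ⟨h1, h2⟩ := hQL p hp
    constructor
    · ext y z
      have h3 := congrArg (fun M => M y z) h1
      simp [Q] at h3 ⊢
      linarith
    · ext y
      have h3 := congrArg (fun M => M y) h2
      simp [L] at h3 ⊢
      linarith
  -- the equation `Vᶜ(F²) = -4 c F²` at one point, divided by the positive factor `φ`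
  have hpt : ∀ p ∈ T, ∀ y, y ≠ 0 →
      Q p y y * (φ (B p y / √(A p y y)) - B p y / √(A p y y) * deriv φ (B p y / √(A p y y)))
        + 2 * √(A p y y) * deriv φ (B p y / √(A p y y)) * L p y = 0 := by
    intro p hp y hy
    have hAd := hA.differentiableAt hT hp
    have hN0 := hA.pos p hp y hy
    have hx := hasFDerivAt_sq_sqrt_mul (hasFDerivAt_apply_apply hAd y y)
      (hasFDerivAt_apply (hBd p hp) y) hN0 (hφd p hp y hy)
    have hAz : HasFDerivAt (fun z => A p z z) (A p y + (A p).flip y) y := by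
      refine ((A p).hasFDerivAt.clm_apply (hasFDerivAt_id y)).congr_fderiv ?_
      ext v
      simp
    have hz := hasFDerivAt_sq_sqrt_mul hAz (B p).hasFDerivAt hN0 (hφd p hp y hy)
    have h1 := hc p hp y hy
    simp only [sqr, abNorm] at h1
    rw [hx.fderiv, hz.fderiv] at h1
    have hα : √(A p y y) ≠ 0 := (Real.sqrt_pos.2 hN0).ne'
    have hα2 : √(A p y y) ^ 2 = A p y y := Real.sq_sqrt hN0.le
    refine mul_left_cancel₀ (hpos p hp y hy).ne' ?_
    simp only [Q, L, add_apply, smul_apply, smul_eq_mul, lieBilin_apply,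
      lieForm_apply]
    simp at h1
    set s := B p y / √(A p y y) with hs
    have hBs : B p y = s * √(A p y y) := by rw [hs]; field_simp
    rw [hBs]
    rw [mul_pow, hα2] at h1
    linear_combination h1 + 4 * c p * φ s * deriv φ s * s * hα2
  -- the set where `V` fails to scale `α²` and `β` is open
  set O : Set (Coord n) := {p | p ∈ T ∧ ¬ (Q p = 0 ∧ L p = 0)} with hO
  have hOT : O ⊆ T := fun p hp => hp.1
  have hOopen : IsOpen O := by
    have hQc : ∀ y z, ContinuousOn (fun p => Q p y z) T := by
      intro y z
      have hAc := hA.contDiffOn.continuousOn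
      have hA' := (hA.contDiffOn.fderiv_of_isOpen (m := ∞) hT (by simp)).continuousOn
      have hV' := (hV.fderiv_of_isOpen (m := ∞) hT (by simp)).continuousOn
      have hVc := hV.continuousOn
      simp only [Q, add_apply, smul_apply, smul_eq_mul, lieBilin_apply]
      have k : ContinuousOn (fun _ : Coord n => y) T := continuousOn_const
      have k' : ContinuousOn (fun _ : Coord n => z) T := continuousOn_const
      exact ((((hA'.clm_apply hVc).clm_apply k).clm_apply k').add
        ((hAc.clm_apply (hV'.clm_apply k)).clm_apply k')).add
        ((hAc.clm_apply k).clm_apply (hV'.clm_apply k')) |>.add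
        ((continuousOn_const.mul hcc).mul ((hAc.clm_apply k).clm_apply k'))
    have hLc : ∀ y, ContinuousOn (fun p => L p y) T := by
      intro y
      have hBc := hB.continuousOn
      have hB' := (hB.fderiv_of_isOpen (m := ∞) hT (by simp)).continuousOn
      have hV' := (hV.fderiv_of_isOpen (m := ∞) hT (by simp)).continuousOn
      have hVc := hV.continuousOn
      simp only [L, add_apply, smul_apply, smul_eq_mul, lieForm_apply]
      have k : ContinuousOn (fun _ : Coord n => y) T := continuousOn_const
      exact (((hB'.clm_apply hVc).clm_apply k).add (hBc.clm_apply (hV'.clm_apply k))).add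
        ((continuousOn_const.mul hcc).mul (hBc.clm_apply k))
    rw [isOpen_iff_mem_nhds]
    rintro p ⟨hp, hne⟩
    rw [not_and_or] at hne
    rcases hne with hne | hne
    · obtain ⟨y, z, hyz⟩ : ∃ y z, Q p y z ≠ 0 := by
        by_contra! hcon
        exact hne (by ext y z; simp [hcon])
      filter_upwards [hT.mem_nhds hp,
        ((hQc y z).continuousAt (hT.mem_nhds hp)).eventually_ne hyz] with q hq hq'
      exact ⟨hq, fun h => hq' (by rw [h.1]; rfl)⟩
    · obtain ⟨y, hyz⟩ : ∃ y, L p y ≠ 0 := by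
        by_contra! hcon
        exact hne (by ext y; simp [hcon])
      filter_upwards [hT.mem_nhds hp,
        ((hLc y).continuousAt (hT.mem_nhds hp)).eventually_ne hyz] with q hq hq'
      exact ⟨hq, fun h => hq' (by rw [h.2]; rfl)⟩
  have halt : ∀ p ∈ O, B p ≠ 0 → ∃ r > 0, ∃ k : ℝ,
      (∀ s ∈ Icc (-r) r, φ s ^ 2 = 1 + k * s ^ 2 ∧ 0 < φ s) ∧
      ∀ y, y ≠ 0 → B p y / √(A p y y) ∈ Icc (-r) r := by
    rintro p ⟨hp, hne⟩ hBp
    obtain ⟨m, -, hm⟩ := hA.exists_dual hB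
    obtain ⟨y, hy, hBy⟩ := exists_ne_zero_apply_eq_zero hfin (B p)
    have h0S : (0 : ℝ) ∈ S := by simpa [hBy] using hmem p hp y hy
    have hc0 : ContinuousAt (deriv φ) 0 :=
      ((hφ.deriv_of_isOpen (m := ∞) hS (by simp)).continuousOn).continuousAt (hS.mem_nhds h0S)
    refine (eq_zero_or_sq_eq hfin (hA.symm p hp) (hA.pos p hp) (Q := Q p) (L := L p) (fun y z => ?_)
      (hm p hp) hBp (hφd p hp) hc0 (hpos p hp) h0 (hpt p hp)).resolve_left hne
    simp [Q, hA.lieBilin_symm hT hp y z, hA.symm p hp y z]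
  by_contra hcon
  push Not at hcon
  obtain ⟨p₀, hp₀, hp₀'⟩ := hcon
  have hOne : O.Nonempty := ⟨p₀, hp₀, fun h => hp₀' h.1 h.2⟩
  have hzero : ∀ p, B p = 0 → ∀ k : ℝ, ∀ y,
      φ (B p y / √(A p y y)) = √(1 + k * (B p y / √(A p y y)) ^ 2) := by
    intro p hp k y
    simp [hp, h0]
  by_cases hall : ∀ p ∈ O, B p = 0
  · obtain ⟨p, hp, y, -, hne⟩ := hφk O hOT hOopen hOne 0
    exact hne (hzero p (hall p hp) 0 y)
  · push Not at hall
    obtain ⟨p₁, hp₁, hB₁⟩ := hall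
    obtain ⟨r₁, hr₁, k₁, h₁, -⟩ := halt p₁ hp₁ hB₁
    obtain ⟨p, hp, y, hy, hne⟩ := hφk O hOT hOopen hOne k₁
    by_cases hBp : B p = 0
    · exact hne (hzero p hBp k₁ y)
    · obtain ⟨r, hr, k, h, hval⟩ := halt p hp hBp
      -- the two constants agree, by comparison at a common nonzero value of `s`
      have hkk : k = k₁ := by
        have hs : 0 < min r r₁ := lt_min hr hr₁
        have e1 := (h (min r r₁) ⟨by linarith, min_le_left _ _⟩).1
        have e2 := (h₁ (min r r₁) ⟨by linarith, min_le_right _ _⟩).1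
        refine mul_right_cancel₀ (pow_pos hs 2).ne' ?_
        linarith
      obtain ⟨e1, e2⟩ := h _ (hval y hy)
      apply hne
      rw [← hkk, ← e1, Real.sqrt_sq e2.le]

/-- The local statement: on an open subset `T` of a coordinate space, the conformal factor of `V` has
derivative zero. Here `m` is the field dual to `β`, so that `b² = β(m)`, and `X` is the field dual to
`ρ = w(b²) β` with respect to `h`. -/
theorem fderiv_conformalFactor_eq_zero (hn : 2 ≤ n) (hT : IsOpen T) (hA : IsMetricOn T A)
    (hB : ContDiffOn ℝ ∞ B T) (hV : ContDiffOn ℝ ∞ V T) (hS : IsOpen S) (hφ : ContDiffOn ℝ ∞ φ S)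
    (hmem : ∀ p ∈ T, ∀ y, y ≠ 0 → B p y / √(A p y y) ∈ S)
    (hpos : ∀ p ∈ T, ∀ y, y ≠ 0 → 0 < φ (B p y / √(A p y y))) (h0 : φ 0 = 1)
    (hφk : ∀ U ⊆ T, IsOpen U → U.Nonempty → ∀ k : ℝ, ∃ p ∈ U, ∃ y, y ≠ 0 ∧
      φ (B p y / √(A p y y)) ≠ √(1 + k * (B p y / √(A p y y)) ^ 2))
    (hc : ∀ p ∈ T, ∀ y, y ≠ 0 → fderiv ℝ (fun q => sqr (abNorm A B φ) q y) p (V p)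
      + fderiv ℝ (fun z => sqr (abNorm A B φ) p z) y (fderiv ℝ V p y)
        = -4 * c p * sqr (abNorm A B φ) p y)
    {m : Coord n → Coord n} (hm : ContDiffOn ℝ ∞ m T) (hmB : ∀ p ∈ T, ∀ y, A p (m p) y = B p y)
    {u v w : ℝ → ℝ} {J : Set ℝ} (hJ : IsOpen J) (hmJ : ∀ p ∈ T, B p (m p) ∈ J)
    (hu : ContDiffOn ℝ ∞ u J) (hv : ContDiffOn ℝ ∞ v J) (hw : ContDiffOn ℝ ∞ w J)
    (hw0 : ∀ t ∈ J, w t ≠ 0) (hH : IsMetricOn T H)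
    (hHA : ∀ p ∈ T, ∀ y z, H p y z
      = u (B p (m p)) * A p y z + v (B p (m p)) * (B p y * B p z))
    {X : Coord n → Coord n} (hX : ContDiffOn ℝ ∞ X T)
    (hXB : ∀ p ∈ T, ∀ y, H p (X p) y = w (B p (m p)) * B p y) {σ : Coord n → ℝ}
    (hσ : ∀ p ∈ T, ∀ y, y ≠ 0 → lieBilin X H p y y = -4 * σ p * H p y y) :
    DifferentiableOn ℝ c T ∧ ∀ p ∈ T, fderiv ℝ c p = 0 := by
  have hfin : 2 ≤ Module.finrank ℝ (Coord n) := by simpa using hn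
  have hBd : ∀ p ∈ T, DifferentiableAt ℝ B p := fun p hp =>
    (hB.contDiffAt (hT.mem_nhds hp)).differentiableAt (by simp)
  have hf0 : ∀ p ∈ T, ∀ y, y ≠ 0 → sqr (abNorm A B φ) p y ≠ 0 := fun p hp y hy =>
    (pow_pos (mul_pos (Real.sqrt_pos.2 (hA.pos p hp y hy)) (hpos p hp y hy)) 2).ne'
  have hcs : ContDiffOn ℝ ∞ c T := contDiffOn_conformalFactor (by omega) hT
    (smoothOff_sqr_abNorm hA hB hφ hmem) hf0 hV hc
  have hcd : ∀ p ∈ T, DifferentiableAt ℝ c p := fun p hp =>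
    (hcs.contDiffAt (hT.mem_nhds hp)).differentiableAt (by simp)
  have hLie := lieBilin_eq_and_lieForm_eq hn hT hA hB hV hS hφ hmem hpos h0 hφk hcs.continuousOn hc
  refine ⟨hcs.differentiableOn (by simp), ?_⟩
  -- `V` preserves `b²`, so that `h` and `ρ` scale as `α` and `β` do
  have hmd : ∀ p ∈ T, DifferentiableAt ℝ m p := fun p hp =>
    (hm.contDiffAt (hT.mem_nhds hp)).differentiableAt (by simp)
  have hbd : ∀ p ∈ T, DifferentiableAt ℝ (fun q => B q (m q)) p := fun p hp =>
    (hBd p hp).clm_apply (hmd p hp)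
  have hb0 : ∀ p ∈ T, fderiv ℝ (fun q => B q (m q)) p (V p) = 0 := fun p hp =>
    fderiv_apply_dual_eq_zero hT hA hp (hmd p hp) hmB (hBd p hp) (hLie p hp).1 (hLie p hp).2
  have hcomp : ∀ g : ℝ → ℝ, ContDiffOn ℝ ∞ g J → ∀ p ∈ T,
      DifferentiableAt ℝ (fun q => g (B q (m q))) p ∧
        fderiv ℝ (fun q => g (B q (m q))) p (V p) = 0 := by
    intro g hg p hp
    have hgd : DifferentiableAt ℝ g (B p (m p)) :=
      (hg.contDiffAt (hJ.mem_nhds (hmJ p hp))).differentiableAt (by simp)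
    have h1 : HasFDerivAt (fun q => g (B q (m q))) _ p :=
      hgd.hasDerivAt.comp_hasFDerivAt p (hbd p hp).hasFDerivAt
    refine ⟨h1.differentiableAt, ?_⟩
    rw [h1.fderiv, smul_apply, hb0 p hp, smul_zero]
  have hVH : ∀ p ∈ T, lieBilin V H p = (-4 * c p) • H p := fun p hp =>
    lieBilin_deformation hT hA hH hp (hBd p hp) (hLie p hp).1 (hLie p hp).2 (hcomp u hu p hp).1
      (hcomp v hv p hp).1 (hcomp u hu p hp).2 (hcomp v hv p hp).2 hHA
  have hXd : ∀ p ∈ T, DifferentiableAt ℝ X p := fun p hp =>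
    (hX.contDiffAt (hT.mem_nhds hp)).differentiableAt (by simp)
  have hVX : ∀ p ∈ T, fderiv ℝ X p (V p) - fderiv ℝ V p (X p) = (2 * c p) • X p := fun p hp =>
    fderiv_dual_sub hT hH hp (hXd p hp) (B := fun q => w (B q (m q)) • B q)
      (fun q hq y => by simp [hXB q hq]) ((hcomp w hw p hp).1.smul (hBd p hp)) (hVH p hp)
      (lieForm_smul (hBd p hp) (hLie p hp).2 (hcomp w hw p hp).1 (hcomp w hw p hp).2)
  -- `σ` is smooth, and the conformal equation holds for bilinear forms by polarization
  have hσs : ContDiffOn ℝ ∞ σ T := by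
    refine contDiffOn_conformalFactor (by omega) hT (smoothOff_metric hH.contDiffOn)
      (fun p hp y hy => (hH.pos p hp y hy).ne') hX fun p hp y hy => ?_
    rw [(hasFDerivAt_apply_apply (hH.differentiableAt hT hp) y y).fderiv]
    have hHz : HasFDerivAt (fun z => H p z z) (H p y + (H p).flip y) y := by
      refine ((H p).hasFDerivAt.clm_apply (hasFDerivAt_id y)).congr_fderiv ?_
      ext v
      simp
    rw [hHz.fderiv, ← hσ p hp y hy, lieBilin_apply]
    simp
    ring
  have hXH : ∀ p ∈ T, lieBilin X H p = (-4 * σ p) • H p := by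
    intro p hp
    have hquad : ∀ y, lieBilin X H p y y = -4 * σ p * H p y y := by
      intro y
      by_cases hy : y = 0
      · simp [hy]
      · exact hσ p hp y hy
    ext y z
    have h1 := hquad (y + z)
    simp only [map_add, add_apply, hquad y, hquad z,
      hH.lieBilin_symm hT hp z y, hH.symm p hp z y] at h1
    simp only [smul_apply, smul_eq_mul]
    linear_combination h1 / 2
  have hmain : ∀ p ∈ T, B p ≠ 0 → fderiv ℝ c p = 0 := by
    intro p hp hBp
    obtain ⟨μ, hμ⟩ := exists_fderiv_mul_eq hT hH hV hX hp (hcd p hp)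
      ((hσs.contDiffAt (hT.mem_nhds hp)).differentiableAt (by simp)) hVH hXH hVX
    refine eq_zero_of_mul_eq hfin (hH.pos p hp) (g := w (B p (m p)) • B p) (μ := μ) (fun y => ?_)
      (smul_ne_zero (hw0 _ (hmJ p hp)) hBp)
    rw [← hμ y, hXB p hp]
    rfl
  -- `β` vanishes on no open set, so that `dc = 0` by continuity
  by_contra hcon
  push Not at hcon
  obtain ⟨p₀, hp₀, hne⟩ := hcon
  have hdc : ContinuousAt (fderiv ℝ c) p₀ :=
    (hcs.fderiv_of_isOpen (m := ∞) hT (by simp)).continuousOn.continuousAt (hT.mem_nhds hp₀)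
  have hev : {p | p ∈ T ∧ fderiv ℝ c p ≠ 0} ∈ 𝓝 p₀ := by
    filter_upwards [hT.mem_nhds hp₀, hdc.eventually_ne hne] with q h1 h2 using ⟨h1, h2⟩
  obtain ⟨U, hU, hUo, hpU⟩ := mem_nhds_iff.1 hev
  obtain ⟨p, hp, y, -, hy⟩ := hφk U (fun q hq => (hU hq).1) hUo ⟨p₀, hpU⟩ 0
  refine (hU hp).2 (hmain p (hU hp).1 fun hBp => hy ?_)
  simp [hBp, h0]

end Local

/-! ### The spray of a Riemannian metric -/

section RiemannianSpray

open Set Filter Topology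

variable {n : ℕ} {T : Set (Coord n)} {H : Coord n → Coord n →L[ℝ] Coord n →L[ℝ] ℝ}

/-- For the norm of a Riemannian metric, `θ_{0|0}` is half the Lie derivative of the metric along
the vector field dual to `θ`. -/
theorem hcov00_metric (hT : IsOpen T) (hH : IsMetricOn T H) {X : Coord n → Coord n}
    (hX : ContDiffOn ℝ ∞ X T) {θ : Fin n → Coord n → Coord n → ℝ}
    (hθ : ∀ i, ∀ p ∈ T, ∀ y, θ i p y = H p (X p) (e i)) {p y : Coord n} (hp : p ∈ T) (hy : y ≠ 0) :
    hcov00 (fun p y => √(H p y y)) θ p y = (1 / 2) * lieBilin X H p y y := by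
  have hnn : ∀ q ∈ T, ∀ z, 0 ≤ H q z z := by
    intro q hq z
    by_cases hz : z = 0
    · simp [hz]
    · exact (hH.pos q hq z hz).le
  have hsq : ∀ q ∈ T, ∀ z, sqr (fun p y => √(H p y y)) q z = H q z z := fun q hq z =>
    Real.sq_sqrt (hnn q hq z)
  have hF : Homog 1 (fun p y => √(H p y y)) := by
    intro q z t ht
    simp only [map_smul, smul_apply, smul_eq_mul]
    rw [← mul_assoc, Real.sqrt_mul (mul_self_nonneg t), Real.sqrt_mul_self ht.le, pow_one]
  have hf : SmoothOff T (sqr (fun p y => √(H p y y))) :=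
    ContDiffOn.congr (smoothOff_metric hH.contDiffOn) fun z hz => hsq _ hz.1 _
  have hder : ∀ q ∈ T, ∀ z, HasFDerivAt (fun z => sqr (fun p y => √(H p y y)) q z)
      ((2 : ℝ) • H q z) z := by
    intro q hq z
    have h1 : (fun z => sqr (fun p y => √(H p y y)) q z) = fun z => H q z z :=
      funext fun z => hsq q hq z
    rw [h1]
    refine ((H q).hasFDerivAt.clm_apply (hasFDerivAt_id z)).congr_fderiv ?_
    ext v
    simp [hH.symm q hq v z]
    ring
  have hfund : ∀ q ∈ T, ∀ z, z ≠ 0 → ∀ i j, fund (fun p y => √(H p y y)) q z i j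
      = H q (e i) (e j) := by
    intro q hq z hz i j
    rw [fund_eq hT hf hq hz]
    have h1 : fderiv ℝ (fun z => sqr (fun p y => √(H p y y)) q z) = fun z => (2 : ℝ) • H q z :=
      funext fun z => (hder q hq z).fderiv
    have h2 : HasFDerivAt (fun z => (2 : ℝ) • H q z) ((2 : ℝ) • H q) z :=
      (H q).hasFDerivAt.fun_const_smul 2
    rw [h1, h2.fderiv]
    simp
  have hdet : ∀ q ∈ T, ∀ z, z ≠ 0 → (fund (fun p y => √(H p y y)) q z).det ≠ 0 := by
    intro q hq z hz
    refine det_fund_ne_zero hT hf hq hz fun v hv => ?_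
    have hc := iteratedDeriv_two_line (contDiffAt_sqr hT hf hq hz) v
    rw [hc]
    have h1 : fderiv ℝ (fun z => sqr (fun p y => √(H p y y)) q z) = fun z => (2 : ℝ) • H q z :=
      funext fun z => (hder q hq z).fderiv
    have h2 : HasFDerivAt (fun z => (2 : ℝ) • H q z) ((2 : ℝ) • H q) z :=
      (H q).hasFDerivAt.fun_const_smul 2
    rw [h1, h2.fderiv]
    have := hH.pos q hq v hv
    simpa using this
  have hlow : ∀ i, ∀ q ∈ T, ∀ z, z ≠ 0 → θ i q z = lower (fun p y => √(H p y y)) X i q z := by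
    intro i q hq z hz
    rw [hθ i q hq z, hH.symm q hq, ← sum_mul_apply_e (H q (e i)) (X q)]
    simp only [lower, hfund q hq z hz]
    exact Finset.sum_congr rfl fun m _ => mul_comm _ _
  rw [hcov00_eq hT hF hf hdet (hX.differentiableOn (by simp)) hlow hp hy, (hder p hp y).fderiv]
  have h2 : (fun q => sqr (fun p y => √(H p y y)) q y) =ᶠ[𝓝 p] fun q => H q y y := by
    filter_upwards [hT.mem_nhds hp] with q hq using hsq q hq y
  rw [h2.fderiv_eq, (hasFDerivAt_apply_apply (hH.differentiableAt hT hp) y y).fderiv,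
    lieBilin_apply, hH.symm p hp (fderiv ℝ X p y) y]
  simp
  ring

end RiemannianSpray

/-! ### Coordinate expressions on a manifold -/

section Charts

open Set Filter Topology

variable {n : ℕ} {M : Type*} [TopologicalSpace M] [ChartedSpace (Coord n) M]

/-- A function on a connected manifold whose derivative vanishes in all charts is constant. -/
theorem exists_eq_const_of_fderiv_eq_zero [PreconnectedSpace M] [Nonempty M] {c : M → ℝ}
    (h : ∀ x₀ : M, DifferentiableOn ℝ (fun p => c ((extChartAt (𝓡 n) x₀).symm p))
        (extChartAt (𝓡 n) x₀).target ∧ ∀ p ∈ (extChartAt (𝓡 n) x₀).target,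
        fderiv ℝ (fun p => c ((extChartAt (𝓡 n) x₀).symm p)) p = 0) :
    ∃ k : ℝ, ∀ x, c x = k := by
  have hloc : IsLocallyConstant c := by
    rw [IsLocallyConstant.iff_eventually_eq]
    intro x₀
    have hT : IsOpen (extChartAt (𝓡 n) x₀).target := isOpen_extChartAt_target x₀
    obtain ⟨ε, hε, hball⟩ := Metric.isOpen_iff.1 hT _ (mem_extChartAt_target (I := 𝓡 n) x₀)
    have hnhds : (extChartAt (𝓡 n) x₀) ⁻¹' Metric.ball (extChartAt (𝓡 n) x₀ x₀) ε ∈ 𝓝 x₀ :=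
      (continuousAt_extChartAt (I := 𝓡 n) x₀).preimage_mem_nhds (Metric.ball_mem_nhds _ hε)
    filter_upwards [hnhds, extChartAt_source_mem_nhds (I := 𝓡 n) x₀] with x hx hxs
    have h1 := Metric.isOpen_ball.is_const_of_fderiv_eq_zero
      (convex_ball (extChartAt (𝓡 n) x₀ x₀) ε).isPreconnected ((h x₀).1.mono hball)
      (fun p hp => (h x₀).2 p (hball hp)) hx (Metric.mem_ball_self hε)
    have h2 : c ((extChartAt (𝓡 n) x₀).symm (extChartAt (𝓡 n) x₀ x))
        = c ((extChartAt (𝓡 n) x₀).symm (extChartAt (𝓡 n) x₀ x₀)) := h1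
    rwa [(extChartAt (𝓡 n) x₀).left_inv hxs, extChartAt_to_inv] at h2
  obtain ⟨x₀⟩ := ‹Nonempty M›
  exact ⟨c x₀, fun x => hloc.apply_eq_of_preconnectedSpace x x₀⟩

/-- The map `y ↦ yⁱ ∂/∂xⁱ` from coordinates to tangent vectors, that is `chartVec` as a continuous
linear map. It is junk for `p` outside the target of the chart. -/
def chartMap (x₀ : M) (p : Coord n) :
    Coord n →L[ℝ] TangentSpace (𝓡 n) ((extChartAt (𝓡 n) x₀).symm p) :=
  mfderiv 𝓘(ℝ, Coord n) (𝓡 n) (extChartAt (𝓡 n) x₀).symm p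

/-- The components of a 1-form in a chart. -/
def coordForm (β : (x : M) → TangentSpace (𝓡 n) x →L[ℝ] ℝ) (x₀ : M) (p : Coord n) :
    Coord n →L[ℝ] ℝ :=
  (β ((extChartAt (𝓡 n) x₀).symm p)).comp (chartMap x₀ p)

theorem coordForm_apply (β : (x : M) → TangentSpace (𝓡 n) x →L[ℝ] ℝ) (x₀ : M) (p y : Coord n) :
    coordForm β x₀ p y = β _ (chartVec x₀ p y) := rfl

variable [IsManifold (𝓡 n) ∞ M]

theorem isInvertible_chartVec (x₀ : M) {p : Coord n} (hp : p ∈ (extChartAt (𝓡 n) x₀).target) :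
    (mfderiv 𝓘(ℝ, Coord n) (𝓡 n) (extChartAt (𝓡 n) x₀).symm p).IsInvertible := by
  have : IsManifold (𝓡 n) 1 M := IsManifold.of_le (n := ∞) (by exact_mod_cast le_top)
  have h := isInvertible_mfderivWithin_extChartAt_symm (I := 𝓡 n) hp
  rwa [ModelWithCorners.range_eq_univ, mfderivWithin_univ] at h

theorem chartVec_ne_zero (x₀ : M) {p : Coord n} (hp : p ∈ (extChartAt (𝓡 n) x₀).target)
    {y : Coord n} (hy : y ≠ 0) : chartVec x₀ p y ≠ 0 := by
  intro h
  exact hy ((isInvertible_chartVec x₀ hp).injective (h.trans (map_zero _).symm))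

theorem exists_chartVec_eq (x₀ : M) {p : Coord n} (hp : p ∈ (extChartAt (𝓡 n) x₀).target)
    (z : TangentSpace (𝓡 n) ((extChartAt (𝓡 n) x₀).symm p)) : ∃ y, chartVec x₀ p y = z :=
  (isInvertible_chartVec x₀ hp).surjective z

theorem contMDiffOn_chartVec (x₀ : M) (y : Coord n) :
    ContMDiffOn 𝓘(ℝ, Coord n) (𝓡 n).tangent ∞
      (fun p => (⟨(extChartAt (𝓡 n) x₀).symm p, chartVec x₀ p y⟩ : TangentBundle (𝓡 n) M))
      (extChartAt (𝓡 n) x₀).target := by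
  have : IsManifold (𝓡 n) 1 M := IsManifold.of_le (n := ∞) (by exact_mod_cast le_top)
  have hT : IsOpen (extChartAt (𝓡 n) x₀).target := isOpen_extChartAt_target x₀
  have h1 := (contMDiffOn_extChartAt_symm (I := 𝓡 n) (n := ∞) x₀).contMDiffOn_tangentMapWithin
    (m := ∞) (by simp) hT.uniqueMDiffOn
  have h2 : ContMDiff 𝓘(ℝ, Coord n) 𝓘(ℝ, Coord n).tangent ∞
      (fun p => (⟨p, y⟩ : TangentBundle 𝓘(ℝ, Coord n) (Coord n))) := fun p =>
    contMDiffAt_vectorSpace_iff_contDiffAt.2 (contDiffAt_const (c := y))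
  refine (h1.comp h2.contMDiffOn (fun p hp => hp)).congr fun p hp => ?_
  simp only [Function.comp_apply, tangentMapWithin, chartVec]
  rw [mfderivWithin_of_isOpen hT hp]

/-- The components of a Riemannian metric in a chart. -/
def coordMetric (a : Riem n M) (x₀ : M) (p : Coord n) : Coord n →L[ℝ] Coord n →L[ℝ] ℝ :=
  (ContinuousLinearMap.precomp ℝ (chartMap x₀ p)).comp
    ((a.inner ((extChartAt (𝓡 n) x₀).symm p)).comp (chartMap x₀ p))

theorem coordMetric_apply (a : Riem n M) (x₀ : M) (p y z : Coord n) :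
    coordMetric a x₀ p y z = a.inner _ (chartVec x₀ p y) (chartVec x₀ p z) := rfl

theorem isMetricOn_coordMetric (a : Riem n M) (x₀ : M) :
    IsMetricOn (extChartAt (𝓡 n) x₀).target (coordMetric a x₀) := by
  refine ⟨?_, fun p _ y z => ?_, fun p hp y hy => ?_⟩
  · refine contDiffOn_clm_apply.2 fun y => contDiffOn_clm_apply.2 fun z => ?_
    rw [← contMDiffOn_iff_contDiffOn]
    have h1 : ContMDiffOn 𝓘(ℝ, Coord n) ((𝓡 n).prod 𝓘(ℝ)) ∞
        (fun p => Bundle.TotalSpace.mk' ℝ (E := Bundle.Trivial M ℝ)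
          ((extChartAt (𝓡 n) x₀).symm p) (coordMetric a x₀ p y z))
        (extChartAt (𝓡 n) x₀).target := by
      apply ContMDiffOn.clm_bundle_apply₂ (F₁ := Coord n) (F₂ := Coord n)
      · exact a.contMDiff.comp_contMDiffOn (contMDiffOn_extChartAt_symm x₀)
      · exact contMDiffOn_chartVec x₀ y
      · exact contMDiffOn_chartVec x₀ z
    intro p hp
    have h2 := h1 p hp
    simp only [Bundle.contMDiffWithinAt_totalSpace] at h2
    exact h2.2
  · exact a.symm _ _ _
  · exact a.pos _ _ (chartVec_ne_zero x₀ hp hy)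

theorem contDiffOn_coordForm {β : (x : M) → TangentSpace (𝓡 n) x →L[ℝ] ℝ} (hβ : IsSmoothForm β)
    (x₀ : M) : ContDiffOn ℝ ∞ (coordForm β x₀) (extChartAt (𝓡 n) x₀).target := by
  refine contDiffOn_clm_apply.2 fun y => ?_
  rw [← contMDiffOn_iff_contDiffOn]
  have h1 : ContMDiffOn 𝓘(ℝ, Coord n) ((𝓡 n).prod 𝓘(ℝ)) ∞
      (fun p => Bundle.TotalSpace.mk' ℝ (E := Bundle.Trivial M ℝ)
        ((extChartAt (𝓡 n) x₀).symm p) (coordForm β x₀ p y))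
      (extChartAt (𝓡 n) x₀).target := by
    apply ContMDiffOn.clm_bundle_apply (F₁ := Coord n)
    · exact ContMDiff.comp_contMDiffOn hβ (contMDiffOn_extChartAt_symm x₀)
    · exact contMDiffOn_chartVec x₀ y
  intro p hp
  have h2 := h1 p hp
  simp only [Bundle.contMDiffWithinAt_totalSpace] at h2
  exact h2.2

theorem contDiffOn_localField {V : (x : M) → TangentSpace (𝓡 n) x} (hV : IsSmoothField V)
    (x₀ : M) : ContDiffOn ℝ ∞ (localField V x₀) (extChartAt (𝓡 n) x₀).target := by
  have : IsManifold (𝓡 n) 1 M := IsManifold.of_le (n := ∞) (by exact_mod_cast le_top)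
  rw [← contMDiffOn_iff_contDiffOn]
  have hopen : IsOpen (chartAt (Coord n) x₀).source := (chartAt (Coord n) x₀).open_source
  have h1 := (contMDiffOn_extChartAt (I := 𝓡 n) (n := ∞) (x := x₀)).contMDiffOn_tangentMapWithin
    (m := ∞) (by simp) hopen.uniqueMDiffOn
  have h2 := ContMDiff.comp_contMDiffOn hV (contMDiffOn_extChartAt_symm (I := 𝓡 n) (n := ∞) x₀)
  have hm : ∀ p ∈ (extChartAt (𝓡 n) x₀).target,
      (extChartAt (𝓡 n) x₀).symm p ∈ (chartAt (Coord n) x₀).source := by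
    intro p hp
    rw [← extChartAt_source (𝓡 n)]
    exact (extChartAt (𝓡 n) x₀).map_target hp
  have h3 := (contMDiff_snd_tangentBundle_modelSpace (Coord n) 𝓘(ℝ, Coord n)
    (n := ∞)).comp_contMDiffOn (h1.comp h2 hm)
  refine h3.congr fun p hp => ?_
  have h4 := mfderivWithin_of_isOpen (I := 𝓡 n) (I' := 𝓘(ℝ, Coord n))
    (f := extChartAt (𝓡 n) x₀) hopen (hm p hp)
  exact congrArg (fun L => L (V _)) h4.symm

theorem localFun_alphaBeta (a : Riem n M) (β : (x : M) → TangentSpace (𝓡 n) x →L[ℝ] ℝ)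
    (φ : ℝ → ℝ) (x₀ : M) :
    localFun (alphaBeta a β φ) x₀ = abNorm (coordMetric a x₀) (coordForm β x₀) φ := rfl

theorem bsq_eq (a : Riem n M) (β : (x : M) → TangentSpace (𝓡 n) x →L[ℝ] ℝ) (x₀ : M) {p : Coord n}
    (hp : p ∈ (extChartAt (𝓡 n) x₀).target) {m : Coord n}
    (hm : ∀ y, coordMetric a x₀ p m y = coordForm β x₀ p y) :
    bsq a β ((extChartAt (𝓡 n) x₀).symm p) = coordForm β x₀ p m := by
  obtain ⟨z, hz⟩ := exists_chartVec_eq x₀ hp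
    (sharp a ((extChartAt (𝓡 n) x₀).symm p) (β ((extChartAt (𝓡 n) x₀).symm p)))
  have h1 : z = m := by
    rw [← sub_eq_zero]
    refine (isMetricOn_coordMetric a x₀).eq_zero_of_forall hp fun y => ?_
    rw [map_sub, sub_apply, hm, coordMetric_apply, hz, inner_sharp, coordForm_apply, sub_self]
  rw [bsq, ← hz, h1, coordForm_apply]

end Charts

end Finsler

end

theorem theorem1p1 {n : ℕ} (hn : 2 ≤ n) {M : Type*} [TopologicalSpace M]
    [ChartedSpace (Finsler.Coord n) M] [IsManifold (𝓡 n) ∞ M]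
    [T2Space M] [SecondCountableTopology M] [ConnectedSpace M]
    -- the Riemannian metric `α` and the 1-form `β`
    (a : Finsler.Riem n M)
    (β : (x : M) → TangentSpace (𝓡 n) x →L[ℝ] ℝ) (hβ : Finsler.IsSmoothForm β)
    -- `φ` is smooth on an open set `S` containing all values of `β/α`, and `F = αφ(β/α)` is Finsler
    (φ : ℝ → ℝ) (S : Set ℝ) (hS : IsOpen S) (hφ : ContDiffOn ℝ ∞ φ S)
    (hmem : ∀ (x : M) (y : TangentSpace (𝓡 n) x), y ≠ 0 → β x y / Finsler.rnorm a x y ∈ S)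
    (hF : Finsler.IsFinslerMetric (Finsler.alphaBeta a β φ))
    (hφ0 : φ 0 = 1)
    -- `φ(s) ≠ √(1 + k s²)` for every constant `k`, over every nonempty open part of `M`
    (hφk : ∀ U : Set M, IsOpen U → U.Nonempty → ∀ k : ℝ,
      ∃ x ∈ U, ∃ y : TangentSpace (𝓡 n) x, y ≠ 0 ∧
        φ (β x y / Finsler.rnorm a x y) ≠ Real.sqrt (1 + k * (β x y / Finsler.rnorm a x y) ^ 2))
    -- the deformation functions, smooth on an open set `J` containing all values of `b²`
    (u v w : ℝ → ℝ) (J : Set ℝ) (hJ : IsOpen J) (hb : ∀ x : M, Finsler.bsq a β x ∈ J)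
    (hu : ContDiffOn ℝ ∞ u J) (hv : ContDiffOn ℝ ∞ v J) (hw : ContDiffOn ℝ ∞ w J)
    (hu0 : ∀ t ∈ J, u t ≠ 0) (hw0 : ∀ t ∈ J, w t ≠ 0)
    -- the Riemannian metric `h² = u(b²) α² + v(b²) β²`
    (h : Finsler.Riem n M)
    (hh : ∀ (x : M) (y z : TangentSpace (𝓡 n) x),
      h.inner x y z = u (Finsler.bsq a β x) * a.inner x y z
        + v (Finsler.bsq a β x) * (β x y * β x z))
    -- `ρ = w(b²) β` is a conformal 1-form of `h`
    (hρ : Finsler.IsConformalForm (Finsler.rnorm h) (fun x => w (Finsler.bsq a β x) • β x))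
    (V : (x : M) → TangentSpace (𝓡 n) x) (hV : Finsler.IsSmoothField V)
    (c : M → ℝ) (hc : Finsler.IsConformalField (Finsler.alphaBeta a β φ) V c) :
    ∃ k : ℝ, ∀ x : M, c x = k := by
  open Finsler in
  refine exists_eq_const_of_fderiv_eq_zero (n := n) fun x₀ => ?_
  have hT : IsOpen (extChartAt (𝓡 n) x₀).target := isOpen_extChartAt_target x₀
  have hA := isMetricOn_coordMetric a x₀
  have hH := isMetricOn_coordMetric h x₀
  have hB := contDiffOn_coordForm hβ x₀
  have hVl := contDiffOn_localField hV x₀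
  obtain ⟨m, hm, hmB⟩ := hA.exists_dual hB
  have hbs : ∀ p ∈ (extChartAt (𝓡 n) x₀).target,
      bsq a β ((extChartAt (𝓡 n) x₀).symm p) = coordForm β x₀ p (m p) := fun p hp =>
    bsq_eq a β x₀ hp (hmB p hp)
  have hmJ : ∀ p ∈ (extChartAt (𝓡 n) x₀).target, coordForm β x₀ p (m p) ∈ J := fun p hp => by
    rw [← hbs p hp]
    exact hb _
  have hmem' : ∀ p ∈ (extChartAt (𝓡 n) x₀).target, ∀ y, y ≠ 0 →
      coordForm β x₀ p y / √(coordMetric a x₀ p y y) ∈ S := fun p hp y hy =>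
    hmem _ _ (chartVec_ne_zero x₀ hp hy)
  have hpos : ∀ p ∈ (extChartAt (𝓡 n) x₀).target, ∀ y, y ≠ 0 →
      0 < φ (coordForm β x₀ p y / √(coordMetric a x₀ p y y)) := fun p hp y hy =>
    pos_of_mul_pos_right (hF.pos _ _ (chartVec_ne_zero x₀ hp hy)) (Real.sqrt_nonneg _)
  -- the 1-form `ρ` and its dual vector field with respect to `h`
  have hR : ContDiffOn ℝ ∞ (fun p => w (coordForm β x₀ p (m p)) • coordForm β x₀ p)
      (extChartAt (𝓡 n) x₀).target :=
    (hw.comp (hB.clm_apply hm) hmJ).smul hB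
  obtain ⟨X, hX, hXR⟩ := hH.exists_dual hR
  obtain ⟨σ, hσ⟩ := hρ
  have hf := smoothOff_sqr_abNorm hA hB hφ hmem'
  refine fderiv_conformalFactor_eq_zero (A := coordMetric a x₀) (H := coordMetric h x₀)
    (B := coordForm β x₀) (V := localField V x₀) (φ := φ)
    (σ := fun p => σ ((extChartAt (𝓡 n) x₀).symm p)) hn hT hA hB hVl hS hφ hmem' hpos hφ0
    ?_ ?_ hm hmB hJ hmJ hu hv hw hw0 hH ?_ hX ?_ ?_
  · intro U hU hUo hUne k
    obtain ⟨x, ⟨hxs, hxU⟩, z, hz, hne⟩ :=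
      hφk ((extChartAt (𝓡 n) x₀).source ∩ extChartAt (𝓡 n) x₀ ⁻¹' U)
        (isOpen_extChartAt_preimage' x₀ hUo) (by
          obtain ⟨p, hp⟩ := hUne
          refine ⟨(extChartAt (𝓡 n) x₀).symm p, (extChartAt (𝓡 n) x₀).map_target (hU hp), ?_⟩
          rw [Set.mem_preimage, (extChartAt (𝓡 n) x₀).right_inv (hU hp)]
          exact hp) k
    obtain ⟨p, hpU, rfl⟩ : ∃ p ∈ U, (extChartAt (𝓡 n) x₀).symm p = x :=
      ⟨_, hxU, (extChartAt (𝓡 n) x₀).left_inv hxs⟩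
    obtain ⟨y, rfl⟩ := exists_chartVec_eq x₀ (hU hpU) z
    refine ⟨p, hpU, y, ?_, hne⟩
    rintro rfl
    exact hz (map_zero (mfderiv 𝓘(ℝ, Coord n) (𝓡 n) (extChartAt (𝓡 n) x₀).symm p))
  · intro p hp y hy
    have h1 := hc x₀ p hp y hy
    rw [localFun_alphaBeta] at h1
    rw [hcov00_eq hT homog_abNorm hf (fun q hq z hz => det_fund_ne_zero hT hf hq hz fun v hv => ?_)
      (hVl.differentiableOn (by simp)) (fun _ _ _ _ _ => rfl) hp hy] at h1
    · simp only [sqr] at h1 ⊢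
      linear_combination 2 * h1
    · have h2 := hF.convex _ _ _ (chartVec_ne_zero x₀ hq hz) (chartVec_ne_zero x₀ hq hv)
      convert h2 using 5 with t
      have h3 : chartVec x₀ q (z + t • v) = chartVec x₀ q z + t • chartVec x₀ q v := by
        exact (map_add (chartMap x₀ q) z (t • v)).trans
          (congrArg _ (map_smul (chartMap x₀ q) t v))
      rw [← h3]
      rfl
  · intro p hp y z
    rw [coordMetric_apply, hh, hbs p hp]
    rfl
  · intro p hp y
    exact hXR p hp y
  · intro p hp y hy
    have h1 := hσ x₀ p hp y hy
    have h2 := hcov00_metric hT hH hX (θ := localForm (fun x => w (bsq a β x) • β x) x₀)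
      (fun i q hq z => by
        rw [hXR q hq, ← hbs q hq]
        rfl) hp hy
    have h3 : localFun (rnorm h) x₀ p y ^ 2 = coordMetric h x₀ p y y :=
      Real.sq_sqrt (hH.pos p hp y hy).le
    rw [h3] at h1
    have h4 := h2.symm.trans h1
    linear_combination 2 * h4
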